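/- **Setting.** Let $N\ge 1$, $G=U(N)$, and let $U(\mathfrak{gl}_N)$ be the universal enveloping algebra over $\mathbb C$ of the Lie algebra of complex $N\times N$ matrices, with coproduct $\Delta$ determined by $\Delta(A)=A\otimes 1+1\otimes A$ $(A\in\mathfrak{gl}_N)$ and with the conjugate-linear anti-automorphism $*$ determined by $E_{ij}^*=E_{ji}$. For $\lambda\in\widehat G$ let $\rho_\lambda$ be a representative irreducible unitary matrix representation of $G$ on $V_\lambda=\mathbb C^{\dim\lambda}$, with character $\chi_\lambda$, and write also $X\mapsto X|_{V_\lambda}$ for the associated representation of $U(\mathfrak{gl}_N)$. Then $L^2(G)=\widehat\bigoplus_{\lambda}\bigoplus_{i=1}^{\dim\lambda}V_\lambda^{(i)}$ with $V^{(i)}_\lambda=\{g\mapsto(\rho_\lambda(g)v)_i: v\in V_\lambda\}$. For $X\in U(\mathfrak{gl}_N)$ let $\pi(X)$ be the operator on the algebraic sum of these summands with $\pi(X)\big[g\mapsto(\rho_\lambda(g)v)_i\big]=\big[g\mapsto(\rho_\lambda(g)Xv)_i\big]$. Let $M$ be the $*$-algebra of operators on the algebraic sum of the summands generated by all bounded operators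 that preserve every summand $V_\lambda^{(i)}$ and by all $\pi(X)$, $X\in U(\mathfrak{gl}_N)$. For $t\ge 0$ put $\kappa_t(g)=e^{t\,\mathrm{Tr}(g-\mathrm{Id})}$ on $G$, with expansion $\kappa_t=\sum_\lambda\widehat{\kappa_t}(\lambda)\,\chi_\lambda/\dim\lambda$, that is $\widehat{\kappa_t}(\lambda)=\dim\lambda\int_G\kappa_t\,\overline{\chi_\lambda}$ with respect to the Haar probability measure. Put $$\kappa_t(T)=\sum_{\lambda}\frac{\widehat{\kappa_t}(\lambda)}{(\dim\lambda)^2}\sum_{i=1}^{\dim\lambda}\mathrm{Tr}\big(T|_{V_\lambda^{(i)}}\big)\quad(T\in M),\qquad \langle X\rangle_t=\kappa_t(\pi(X))\quad (X\in U(\mathfrak{gl}_N)),$$ and let $P_t=(\mathrm{id}\otimes\langle\cdot\rangle_t)\circ\Delta:U(\mathfrak{gl}_N)\to U(\mathfrak{gl}_N)$. Fix times $0\le t_1<t_2<\dots$. Let $\mathcal W=M^{\otimes\infty}$ be the infinite algebraic tensor product (spanned by the tensors $a_1\otimes a_2\otimes\cdots$ with $a_k=\mathrm{Id}$ for all but finitely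 many $k$), and let $\omega=\kappa_{t_1}\otimes\kappa_{t_2-t_1}\otimes\kappa_{t_3-t_2}\otimes\cdots$ be the product functional on $\mathcal W$. For $n\ge1$ let $j_n=\pi^{\otimes n}\otimes\mathrm{Id}^{\otimes\infty}:U(\mathfrak{gl}_N)\to\mathcal W$ be the algebra morphism with $j_n(A)=\sum_{k=1}^n\mathrm{Id}^{\otimes (k-1)}\otimes\pi(A)\otimes\mathrm{Id}^{\otimes\infty}$ for $A\in\mathfrak{gl}_N$, and let $\mathcal W_n$ be the subalgebra generated by the images of $j_1,\dots,j_n$. A state on a unital $*$-algebra is a linear functional $\phi$ with $\phi(1)=1$ and $\phi(a^*a)\ge0$ for all $a$. A linear map $Q$ of a $*$-algebra $A$ to itself is completely positive if, for every $n$, its entrywise application to $n\times n$ matrices over $A$ sends every $B^*B$ to a finite sum of elements of the form $C^*C$. **Theorem.** For every $t\ge0$ the series $\kappa_t(T)$ converges absolutely for all $T\in M$, and $\kappa_t$ and $\langle\cdot\rangle_t$ are states on $M$ and on $U(\mathfrak{gl}_N)$. Moreover: (1) $(P_t)_{t\ge0}$ is a non-commutative Markov operator, i.e. a semigroup of completely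 positive unital linear maps, and the maps $(j_n)$ are a dilation of it: $\omega$ is a state on $\mathcal W$, and $\omega(j_n(X)w)=\omega(j_{n-1}(P_{t_n-t_{n-1}}X)\,w)$ for all $n\ge2$, $X\in U(\mathfrak{gl}_N)$, $w\in\mathcal W_{n-1}$. (2) $\langle X\rangle_{t_n}=\omega(j_n(X))$ for all $n\ge 1$ and $X\in U(\mathfrak{gl}_N)$. (3) For $n\le m$ and $X,Y\in U(\mathfrak{gl}_N)$, $\omega(j_n(X)j_m(Y))=\langle X\cdot P_{t_m-t_n}Y\rangle_{t_n}$. (4) $P_{t+s}=P_t\circ P_s$ for all $s,t\ge0$. (5) For every subgroup $K\subset U(N)$ and $t\ge0$, $P_t$ maps $U(\mathfrak{gl}_N)^K=\{x:\mathrm{Ad}(g)x=x\text{ for all }g\in K\}$ into itself. In particular, $P_t$ maps the centre $Z(U(\mathfrak{gl}_N))$ into itself. -/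

import Mathlib

open scoped TensorProduct

noncomputable section

namespace NCWalk

attribute [local instance 100] LieRing.ofAssociativeRing

/-! ## The compact group `U(N)` -/

/-- The Lie group `U(N)`. -/
abbrev G (N : ℕ) : Type := Matrix.unitaryGroup (Fin N) ℂ

instance instCompactSpaceG (N : ℕ) : CompactSpace (G N) := by
  refine isCompact_iff_compactSpace.1 (?_ : IsCompact
    (↑(Matrix.unitaryGroup (Fin N) ℂ) : Set (Matrix (Fin N) (Fin N) ℂ)))
  have hK : IsCompact (Set.pi Set.univ fun _ => Set.pi Set.univ fun _ =>
      Metric.closedBall (0 : ℂ) 1 : Set (Matrix (Fin N) (Fin N) ℂ)) :=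
    isCompact_univ_pi (fun _ : Fin N => isCompact_univ_pi
      (fun _ : Fin N => isCompact_closedBall (0 : ℂ) 1))
  refine hK.of_isClosed_subset ?_ ?_
  · have : (↑(Matrix.unitaryGroup (Fin N) ℂ) : Set (Matrix (Fin N) (Fin N) ℂ))
        = {A | star A * A = 1} ∩ {A | A * star A = 1} := by
      ext A; exact Unitary.mem_iff
    rw [this]
    exact (isClosed_eq (by fun_prop) continuous_const).inter
      (isClosed_eq (by fun_prop) continuous_const)
  · intro A hA i _ j _
    simpa using entry_norm_bound_of_unitary hA i j

instance instMeasurableSpaceG (N : ℕ) : MeasurableSpace (G N) := borel _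

instance instBorelSpaceG (N : ℕ) : BorelSpace (G N) := ⟨rfl⟩

/-- The Haar probability measure on `U(N)`. -/
def haarG (N : ℕ) : MeasureTheory.Measure (G N) := MeasureTheory.Measure.haarMeasure ⊤

/-! ## The universal enveloping algebra of `gl_N` -/

/-- The Lie algebra `gl_N` of complex `N × N` matrices. -/
abbrev gl (N : ℕ) : Type := Matrix (Fin N) (Fin N) ℂ

/-- The universal enveloping algebra of `gl_N` over `ℂ`. -/
abbrev U (N : ℕ) : Type := UniversalEnvelopingAlgebra ℂ (gl N)

/-- The canonical map of `gl_N` into its enveloping algebra. -/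
abbrev incl (N : ℕ) : gl N →ₗ⁅ℂ⁆ U N := UniversalEnvelopingAlgebra.ι ℂ

/-- The coproduct: the algebra morphism with `A ↦ A ⊗ 1 + 1 ⊗ A` for `A` in `gl_N`. -/
def coproduct (N : ℕ) : U N →ₐ[ℂ] U N ⊗[ℂ] U N :=
  UniversalEnvelopingAlgebra.lift ℂ
    { toFun := fun A => incl N A ⊗ₜ[ℂ] 1 + 1 ⊗ₜ[ℂ] incl N A
      map_add' := fun A B => by
        simp only [map_add, TensorProduct.add_tmul, TensorProduct.tmul_add]; abel
      map_smul' := fun c A => by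
        rw [map_smul, RingHom.id_apply, smul_add, TensorProduct.smul_tmul', TensorProduct.tmul_smul]
      map_lie' := fun {A B} => by
        rw [LieHom.map_lie]
        simp only [LieRing.of_associative_ring_bracket, TensorProduct.sub_tmul,
          TensorProduct.tmul_sub, mul_add, add_mul, Algebra.TensorProduct.tmul_mul_tmul, one_mul,
          mul_one]
        abel }

/-- The opposite algebra with the conjugate scalar action; conjugate-linear anti-morphisms into
`A` are the algebra morphisms into it. -/
def ConjOp (A : Type) : Type := Aᵐᵒᵖ

instance instRingConjOp (A : Type) [Ring A] : Ring (ConjOp A) := inferInstanceAs (Ring Aᵐᵒᵖ)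

instance instAlgebraConjOp (A : Type) [Ring A] [Algebra ℂ A] : Algebra ℂ (ConjOp A) :=
  RingHom.toAlgebra' ((algebraMap ℂ Aᵐᵒᵖ).comp (starRingEnd ℂ))
    (fun c x => Algebra.commutes (A := Aᵐᵒᵖ) (starRingEnd ℂ c) x)

/-- The involution of `U(gl_N)`, as a morphism into `ConjOp`. -/
def starHom (N : ℕ) : U N →ₐ[ℂ] ConjOp (U N) :=
  UniversalEnvelopingAlgebra.lift ℂ
    { toFun := fun A => (MulOpposite.op (incl N (star A)) : (U N)ᵐᵒᵖ)
      map_add' := fun A B => by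
        rw [star_add, map_add]; rfl
      map_smul' := fun c A => by
        rw [star_smul, map_smul]
        exact Algebra.smul_def (A := (U N)ᵐᵒᵖ) (star c) _
      map_lie' := fun {A B} => by
        rw [LieRing.of_associative_ring_bracket, star_sub, star_mul, star_mul,
          ← LieRing.of_associative_ring_bracket, LieHom.map_lie]
        rfl }

theorem starHom_incl (N : ℕ) (A : gl N) :
    starHom N (incl N A) = (MulOpposite.op (incl N (star A)) : (U N)ᵐᵒᵖ) :=
  UniversalEnvelopingAlgebra.lift_ι_apply ℂ _ A

/-- The conjugate-linear involution of `U(gl_N)`. -/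
def starFun (N : ℕ) (x : U N) : U N := MulOpposite.unop (starHom N x : (U N)ᵐᵒᵖ)

theorem starFun_mul (N : ℕ) (x y : U N) : starFun N (x * y) = starFun N y * starFun N x := by
  unfold starFun; rw [map_mul]; rfl

theorem starFun_add (N : ℕ) (x y : U N) : starFun N (x + y) = starFun N x + starFun N y := by
  unfold starFun; rw [map_add]; rfl

theorem starFun_algebraMap (N : ℕ) (c : ℂ) :
    starFun N (algebraMap ℂ (U N) c) = algebraMap ℂ (U N) (star c) := by
  unfold starFun; rw [AlgHom.commutes]; rfl

theorem starFun_starFun (N : ℕ) (x : U N) : starFun N (starFun N x) = x := by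
  let F : U N →ₐ[ℂ] U N :=
    { toFun := fun x => starFun N (starFun N x)
      map_one' := by
        have h := starFun_algebraMap N 1
        simp only [map_one, star_one] at h
        rw [h, h]
      map_mul' := fun x y => by rw [starFun_mul, starFun_mul]
      map_zero' := by
        have h := starFun_algebraMap N 0
        simp only [map_zero, star_zero] at h
        rw [h, h]
      map_add' := fun x y => by rw [starFun_add, starFun_add]
      commutes' := fun c => by rw [starFun_algebraMap, starFun_algebraMap, star_star] }
  have hF : F = AlgHom.id ℂ (U N) := by
    apply UniversalEnvelopingAlgebra.hom_ext
    ext A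
    change starFun N (starFun N (incl N A)) = incl N A
    have h : ∀ B : gl N, starFun N (incl N B) = incl N (star B) := fun B => by
      unfold starFun; rw [starHom_incl]; rfl
    rw [h, h, star_star]
  exact DFunLike.congr_fun hF x

/-- The `*`-structure of `U(gl_N)`: the conjugate-linear anti-automorphism which extends the
conjugate transposition of matrices (so `E_ij* = E_ji`, and elements of the real form `u(N)` are
skew-adjoint). -/
instance instStarRingU (N : ℕ) : StarRing (U N) where
  star := starFun N
  star_involutive := starFun_starFun N
  star_mul := starFun_mul N
  star_add := starFun_add N

/-- The adjoint action of `g` in `U(N)` on `gl_N`, as a morphism of Lie algebras. -/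
def adGl {N : ℕ} (g : G N) : gl N →ₗ⁅ℂ⁆ gl N where
  toFun A := (g : gl N) * A * star (g : gl N)
  map_add' A B := by rw [mul_add, add_mul]
  map_smul' c A := by simp
  map_lie' {A B} := by
    have h : star (g : gl N) * (g : gl N) = 1 := Unitary.coe_star_mul_self g
    have key : ∀ X Y : gl N, (g : gl N) * (X * Y) * star (g : gl N)
        = ((g : gl N) * X * star (g : gl N)) * ((g : gl N) * Y * star (g : gl N)) := by
      intro X Y
      calc (g : gl N) * (X * Y) * star (g : gl N)
          = (g : gl N) * X * 1 * Y * star (g : gl N) := by simp only [mul_one, mul_assoc]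
        _ = _ := by rw [← h]; simp only [mul_assoc]
    simp only [LieRing.of_associative_ring_bracket, mul_sub, sub_mul]
    rw [key, key]

/-- The adjoint action of `U(N)` on `U(gl_N)`. -/
def Ad {N : ℕ} (g : G N) : U N →ₐ[ℂ] U N :=
  UniversalEnvelopingAlgebra.lift ℂ ((incl N).comp (adGl g))

/-- The `Ad(K)`-invariant elements of `U(gl_N)`. -/
def invariants {N : ℕ} (K : Subgroup (G N)) : Set (U N) := {x | ∀ g ∈ K, Ad g x = x}

/-! ## Irreducible representations of `U(N)` -/

/-- An irreducible continuous unitary matrix representation of `U(N)`, together with its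
differential: the (automatically existing and unique) representation `drho` of the complexified Lie
algebra `gl_N` with `ρ (exp A) = exp (drho A)` for all skew-Hermitian `A`. -/
structure Irrep (N : ℕ) where
  dim : ℕ
  dim_pos : 0 < dim
  rho : G N →* Matrix.unitaryGroup (Fin dim) ℂ
  continuous_rho : Continuous rho
  drho : gl N →ₗ⁅ℂ⁆ Matrix (Fin dim) (Fin dim) ℂ
  rho_exp : ∀ (A : gl N) (g : G N), star A = -A → (g : gl N) = NormedSpace.exp A →
    (rho g : Matrix (Fin dim) (Fin dim) ℂ) = NormedSpace.exp (drho A)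
  irreducible : ∀ p : Submodule ℂ (Fin dim → ℂ),
    (∀ g : G N, ∀ v ∈ p, Matrix.mulVec (rho g : Matrix (Fin dim) (Fin dim) ℂ) v ∈ p) →
      p = ⊥ ∨ p = ⊤

/-- Equivalence of representations. -/
def Irrep.Equiv {N : ℕ} (V W : Irrep N) : Prop :=
  ∃ S : (Fin V.dim → ℂ) ≃ₗ[ℂ] (Fin W.dim → ℂ), ∀ (g : G N) (v : Fin V.dim → ℂ),
    S (Matrix.mulVec (V.rho g : Matrix (Fin V.dim) (Fin V.dim) ℂ) v)
      = Matrix.mulVec (W.rho g : Matrix (Fin W.dim) (Fin W.dim) ℂ) (S v)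

instance instSetoidIrrep (N : ℕ) : Setoid (Irrep N) where
  r := Irrep.Equiv
  iseqv :=
    { refl := fun V => ⟨LinearEquiv.refl ℂ _, fun _ _ => rfl⟩
      symm := by
        rintro V W ⟨S, hS⟩
        refine ⟨S.symm, fun g v => ?_⟩
        rw [LinearEquiv.symm_apply_eq, hS, LinearEquiv.apply_symm_apply]
      trans := by
        rintro V W X ⟨S, hS⟩ ⟨R, hR⟩
        refine ⟨S.trans R, fun g v => ?_⟩
        simp only [LinearEquiv.trans_apply, hS, hR] }

/-- The unitary dual of `U(N)`: the equivalence classes of irreducible representations. -/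
abbrev Dual (N : ℕ) : Type := Quotient (instSetoidIrrep N)

/-- The chosen representative `V_l` of the class `l`. -/
abbrev rep {N : ℕ} (l : Dual N) : Irrep N := Quotient.out l

/-- The character of the class `l`. -/
def character {N : ℕ} (l : Dual N) (g : G N) : ℂ :=
  Matrix.trace ((rep l).rho g : Matrix (Fin (rep l).dim) (Fin (rep l).dim) ℂ)

/-! ## The operator algebra `M` -/

/-- The index set of the Peter–Weyl decomposition of `L²(U(N))`: the summand with index `(l, i)`
is `V_l^(i) = {g ↦ (ρ_l(g) v)_i : v ∈ V_l}`, for `i = 1, …, dim l`. -/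
abbrev Summand (N : ℕ) : Type := Σ l : Dual N, Fin (rep l).dim

/-- All linear operators on the algebraic sum of the Peter–Weyl summands (a dense subspace of
`L²(U(N))`) which preserve every summand. Such an operator is the family of its restrictions to the
mutually orthogonal, finite-dimensional summands. The restriction to `V_l^(i)` is given by
its matrix in the basis of matrix coefficients `g ↦ ρ_l(g)_{i b}`, that is, by the matrix `T` for
which `g ↦ (ρ_l(g) v)_i` is sent to `g ↦ (ρ_l(g) (T v))_i`. These coefficients are
orthogonal and of equal `L²`-norm within a summand, so the adjoint operator has the conjugate
transposed matrices. -/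
abbrev BlockOp (N : ℕ) : Type :=
  ∀ s : Summand N, Matrix (Fin (rep s.1).dim) (Fin (rep s.1).dim) ℂ

open scoped Matrix.Norms.L2Operator in
/-- The bounded operators among these; they form a von Neumann algebra. -/
def boundedOps (N : ℕ) : Set (BlockOp N) := {T | ∃ C : ℝ, ∀ s, ‖T s‖ ≤ C}

/-- The action `π` of `U(gl_N)` on the Peter–Weyl summands:
`X` sends `g ↦ (ρ_l(g) v)_i` to `g ↦ (ρ_l(g) X v)_i`. -/
def piBlock (N : ℕ) : U N →ₐ[ℂ] BlockOp N :=
  AlgHom.pi fun s => UniversalEnvelopingAlgebra.lift ℂ (rep s.1).drho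

/-- The `*`-algebra `M`, generated by all bounded operators which preserve every Peter–Weyl summand
and by the (in general unbounded) operators `π(X)`, `X ∈ U(gl_N)`. -/
def M (N : ℕ) : StarSubalgebra ℂ (BlockOp N) :=
  StarAlgebra.adjoin ℂ (boundedOps N ∪ Set.range (piBlock N))

/-- The action `π : U(gl_N) → M`. -/
def piM (N : ℕ) : U N →ₐ[ℂ] M N :=
  (piBlock N).codRestrict (M N).toSubalgebra
    fun x => StarAlgebra.subset_adjoin ℂ _ (Or.inr ⟨x, rfl⟩)

/-! ## The states `κ_t` -/

/-- The function `κ_t(U) = exp (t Tr (U - 1))` on `U(N)`. -/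
def kappaFun {N : ℕ} (t : ℝ) (g : G N) : ℂ :=
  Complex.exp ((t : ℂ) * Matrix.trace ((g : gl N) - 1))

/-- The coefficients of `κ_t = ∑_l kappaHat t l • χ_l / dim l`. -/
def kappaHat {N : ℕ} (t : ℝ) (l : Dual N) : ℂ :=
  ((rep l).dim : ℂ) * ∫ g : G N, kappaFun t g * star (character l g) ∂(haarG N)

/-- The term with index `l` of the series `κ_t(T) = ∑_l kappaHat t l (dim l)⁻² ∑_i Tr (T|V_l^(i))`. -/
def stateTerm {N : ℕ} (t : ℝ) (T : M N) (l : Dual N) : ℂ :=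
  kappaHat t l / ((rep l).dim : ℂ) ^ 2 *
    ∑ i : Fin (rep l).dim, Matrix.trace ((T : BlockOp N) ⟨l, i⟩)

open Classical in
/-- The state `κ_t` on `M`, the sum of the series `stateTerm t`. (It would be zero if one of
these series diverged.) -/
def kappa {N : ℕ} (t : ℝ) : M N →ₗ[ℂ] ℂ :=
  if h : ∀ T : M N, Summable (stateTerm t T) then
    { toFun := fun T => ∑' l, stateTerm t T l
      map_add' := fun S T => by
        rw [← (h S).tsum_add (h T)]
        refine tsum_congr fun l => ?_
        simp [stateTerm, Matrix.trace_add, Finset.sum_add_distrib, mul_add]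
      map_smul' := fun c T => by
        rw [RingHom.id_apply, smul_eq_mul, ← tsum_mul_left]
        refine tsum_congr fun l => ?_
        change _ / _ * ∑ i : Fin (rep l).dim, Matrix.trace (c • (T : BlockOp N) ⟨l, i⟩) = _
        simp only [stateTerm, Matrix.trace_smul, smul_eq_mul, ← Finset.mul_sum]
        ring }
  else 0

/-- The state `⟨·⟩_t` on `U(gl_N)`, the pullback of `κ_t` under `π`. -/
def bracket {N : ℕ} (t : ℝ) : U N →ₗ[ℂ] ℂ := kappa t ∘ₗ (piM N).toLinearMap

/-- The operator `P_t = (id ⊗ κ_t) ∘ Δ` on `U(gl_N)`. -/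
def P {N : ℕ} (t : ℝ) : U N →ₗ[ℂ] U N :=
  (TensorProduct.rid ℂ (U N)).toLinearMap ∘ₗ (bracket t).lTensor (U N) ∘ₗ
    (coproduct N).toLinearMap

/-! ## Infinite tensor products -/

section InfiniteTensor

variable (A : Type) [Ring A] [StarRing A] [Algebra ℂ A] [StarModule ℂ A]

/-- The full tensor product of countably many copies of `A`. -/
abbrev FullTensor : Type := ⨂[ℂ] _ : ℕ, A

/-- The involution `⊗ a_k ↦ ⊗ a_k*`. -/
def tensorStar : FullTensor A →+ FullTensor A :=
  PiTensorProduct.liftAddHom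
    (fun p : ℂ × (ℕ → A) => star p.1 • PiTensorProduct.tprod ℂ (fun k => star (p.2 k)))
    (fun r f i hf => by
      rw [(PiTensorProduct.tprod ℂ).map_coord_zero i (by simp [hf]), smul_zero])
    (fun f => by simp)
    (fun r f i m₁ m₂ => by
      have h : ∀ m : A, (fun k => star (Function.update f i m k))
          = Function.update (fun k => star (f k)) i (star m) := fun m => by
        ext k; by_cases hk : k = i
        · subst hk; simp
        · simp [hk]
      simp only [h, star_add, MultilinearMap.map_update_add, smul_add])
    (fun r r' f => by simp [add_smul])
    (fun r f i r' => by
      have h : (fun k => star (Function.update f i (r' • f i) k))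
          = Function.update (fun k => star (f k)) i (star r' • star (f i)) := by
        ext k; by_cases hk : k = i
        · subst hk; simp
        · simp [hk]
      simp only [h, MultilinearMap.map_update_smul, Function.update_eq_self, smul_smul, star_mul', mul_comm])

theorem tensorStar_smul_tprod (c : ℂ) (a : ℕ → A) :
    tensorStar A (c • PiTensorProduct.tprod ℂ a)
      = star c • PiTensorProduct.tprod ℂ (fun k => star (a k)) := by
  rw [← PiTensorProduct.tprodCoeff_eq_smul_tprod]
  exact (AddCon.lift_coe _ _).trans (by simp)

/-- The `*`-structure of the tensor product. -/
instance instStarRingFullTensor : StarRing (FullTensor A) where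
  star := tensorStar A
  star_involutive x := by
    induction x using PiTensorProduct.induction_on with
    | smul_tprod r f => simp only [tensorStar_smul_tprod, star_star]
    | add x y hx hy => simp only [map_add, hx, hy]
  star_mul x y := by
    induction x using PiTensorProduct.induction_on with
    | smul_tprod r f =>
      induction y using PiTensorProduct.induction_on with
      | smul_tprod s g =>
        rw [PiTensorProduct.smul_tprod_mul_smul_tprod, tensorStar_smul_tprod,
          tensorStar_smul_tprod, tensorStar_smul_tprod, PiTensorProduct.smul_tprod_mul_smul_tprod,
          star_mul]
        congr 2
        ext k
        simp
      | add x y hx hy => simp only [map_add, mul_add, add_mul, hx, hy]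
    | add x y hx hy => simp only [map_add, mul_add, add_mul, hx, hy]
  star_add x y := map_add (tensorStar A) x y

instance instStarModuleFullTensor : StarModule ℂ (FullTensor A) where
  star_smul c x := by
    change tensorStar A (c • x) = star c • tensorStar A x
    induction x using PiTensorProduct.induction_on with
    | smul_tprod r f => rw [smul_smul, tensorStar_smul_tprod, tensorStar_smul_tprod, smul_smul,
        star_mul']
    | add x y hx hy => simp only [map_add, smul_add, hx, hy]

/-- The infinite tensor product `A^{⊗∞}` of `*`-algebras: the `*`-subalgebra of the full tensor
product generated by the copies of `A` in the single slots. It is the linear span of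
the tensors `⊗ a_k` with `a_k = 1` for all but finitely many `k`. -/
def TensorPower : StarSubalgebra ℂ (FullTensor A) :=
  StarAlgebra.adjoin ℂ
    (⋃ k : ℕ, Set.range (PiTensorProduct.singleAlgHom (R := ℂ) (A := fun _ : ℕ => A) k))

/-- The inclusion `a ↦ 1 ⊗ ⋯ ⊗ 1 ⊗ a ⊗ 1 ⊗ ⋯` of the slot `k`. -/
def slot (k : ℕ) : A →ₐ[ℂ] TensorPower A :=
  (PiTensorProduct.singleAlgHom (R := ℂ) (A := fun _ : ℕ => A) k).codRestrict
    (TensorPower A).toSubalgebra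
    fun a => StarAlgebra.subset_adjoin ℂ _ (Set.mem_iUnion.2 ⟨k, a, rfl⟩)

theorem slot_commute {k l : ℕ} (h : k ≠ l) (a b : A) : Commute (slot A k a) (slot A l b) := by
  have key : Commute (PiTensorProduct.singleAlgHom (R := ℂ) (A := fun _ : ℕ => A) k a)
      (PiTensorProduct.singleAlgHom (R := ℂ) (A := fun _ : ℕ => A) l b) := by
    refine Commute.tprod ?_
    exact Pi.mulSingle_commute (f := fun _ : ℕ => A) h a b
  exact Subtype.ext key

variable {A}

open Classical in
theorem prod_update {A : Type} [Ring A] [Algebra ℂ A] (φ : ℕ → A →ₗ[ℂ] ℂ) [DecidableEq ℕ]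
    (a : ℕ → A) (i : ℕ) (x : A) :
    (if {k | φ k (Function.update a i x k) ≠ 1}.Finite
      then ∏ᶠ k, φ k (Function.update a i x k) else 0)
    = φ i x * (if {k | φ k (a k) ≠ 1}.Finite
      then ∏ᶠ k, (if k = i then 1 else φ k (a k)) else 0) := by
  have hsub : ∀ b c : ℕ → A, (∀ k, k ≠ i → b k = c k) → {k | φ k (c k) ≠ 1}.Finite →
      {k | φ k (b k) ≠ 1}.Finite := by
    intro b c hbc hc
    refine (hc.insert i).subset fun k hk => ?_
    by_cases hki : k = i
    · exact Or.inl hki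
    · refine Or.inr ?_
      simpa [← hbc k hki] using hk
  have hiff : {k | φ k (Function.update a i x k) ≠ 1}.Finite ↔ {k | φ k (a k) ≠ 1}.Finite :=
    ⟨hsub _ _ fun k hk => by simp [hk], hsub _ _ fun k hk => by simp [hk]⟩
  by_cases hf : {k | φ k (a k) ≠ 1}.Finite
  · rw [if_pos (hiff.2 hf), if_pos hf]
    have hsplit : ∀ k, φ k (Function.update a i x k)
        = (if k = i then φ i x else 1) * (if k = i then 1 else φ k (a k)) := by
      intro k
      by_cases hk : k = i
      · subst hk; simp
      · simp [hk]
    rw [finprod_congr hsplit, finprod_mul_distrib]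
    · congr 1
      rw [finprod_eq_single _ i (fun k hk => by simp [hk])]
      simp
    · refine (Set.finite_singleton i).subset fun k hk => ?_
      by_contra hki
      exact hk (by simp [show k ≠ i from hki])
    · refine hf.subset fun k hk => ?_
      by_cases hki : k = i
      · exact absurd (by simp [hki]) hk
      · simpa [hki] using hk
  · rw [if_neg (fun h => hf (hiff.1 h)), if_neg hf, mul_zero]

open Classical in
/-- The product functional `⊗ a_k ↦ ∏ φ_k(a_k)`, for tensors with `φ_k(a_k) = 1` for all but
finitely many `k`. (The other elementary tensors, which are sent to `0`, do not occur in
`A^{⊗∞}` if all the `φ_k` are unital.) -/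
def prodMultilinear (φ : ℕ → A →ₗ[ℂ] ℂ) : MultilinearMap ℂ (fun _ : ℕ => A) ℂ where
  toFun a := if {k | φ k (a k) ≠ 1}.Finite then ∏ᶠ k, φ k (a k) else 0
  map_update_add' := by
    intro inst a i x y
    simp only [prod_update, map_add, add_mul]
  map_update_smul' := by
    intro inst a i c x
    simp only [prod_update, map_smul, smul_eq_mul, mul_assoc]

/-- The product functional `φ_0 ⊗ φ_1 ⊗ ⋯` on `A^{⊗∞}`. -/
def prodFunctional (φ : ℕ → A →ₗ[ℂ] ℂ) : TensorPower A →ₗ[ℂ] ℂ :=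
  PiTensorProduct.lift (prodMultilinear φ) ∘ₗ (TensorPower A).subtype.toAlgHom.toLinearMap

/-- The tensor product of `m` copies of a Lie algebra morphism `f` into `A`, extended by the identity
in the other slots: `x ↦ ∑_{k < m} 1 ⊗ ⋯ ⊗ 1 ⊗ f(x) ⊗ 1 ⊗ ⋯` (with `f(x)` in the slot `k`). -/
def slotSum {L : Type} [LieRing L] [LieAlgebra ℂ L] (f : L →ₗ⁅ℂ⁆ A) (m : ℕ) :
    L →ₗ⁅ℂ⁆ TensorPower A where
  toFun x := ∑ k ∈ Finset.range m, slot A k (f x)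
  map_add' x y := by simp only [map_add, Finset.sum_add_distrib]
  map_smul' c x := by simp only [map_smul, Finset.smul_sum, RingHom.id_apply]
  map_lie' {x y} := by
    have hcomm : ∀ k l : ℕ,
        slot A k (f x) * slot A l (f y) - slot A l (f y) * slot A k (f x)
          = if k = l then slot A k (f ⁅x, y⁆) else 0 := by
      intro k l
      by_cases h : k = l
      · subst h
        rw [if_pos rfl, LieHom.map_lie, LieRing.of_associative_ring_bracket, map_sub, map_mul,
          map_mul]
      · rw [if_neg h, (slot_commute A h (f x) (f y)).eq, sub_self]
    rw [LieRing.of_associative_ring_bracket, Finset.sum_mul_sum, Finset.sum_mul_sum,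
      Finset.sum_comm (f := fun k l => slot A k (f y) * slot A l (f x)),
      ← Finset.sum_sub_distrib]
    refine Finset.sum_congr rfl fun k hk => ?_
    rw [← Finset.sum_sub_distrib, Finset.sum_congr rfl fun l _ => hcomm k l,
      Finset.sum_ite_eq, if_pos hk]

end InfiniteTensor

/-! ## The non-commutative random walk -/

/-- The `*`-algebra `W = M^{⊗∞}`. -/
abbrev W (N : ℕ) : Type := TensorPower (M N)

/-- The increments `t_1, t_2 - t_1, t_3 - t_2, …` (the times are indexed from `0` here, so that
`t 0` is the first time, called `t_1` in these formulas). -/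
def increment (t : ℕ → ℝ) : ℕ → ℝ
  | 0 => t 0
  | k + 1 => t (k + 1) - t k

/-- The product state `ω = κ_{t_1} ⊗ κ_{t_2 - t_1} ⊗ κ_{t_3 - t_2} ⊗ ⋯` on `W`. -/
def omega {N : ℕ} (t : ℕ → ℝ) : W N →ₗ[ℂ] ℂ := prodFunctional fun k => kappa (increment t k)

/-- The morphism `π^{⊗ m} ⊗ Id^{⊗ ∞}`: the algebra morphism which sends `A` in `gl_N` to
`∑_{k < m} Id^{⊗ k} ⊗ π(A) ⊗ Id^{⊗ ∞}`. -/
def tensorPi (N m : ℕ) : U N →ₐ[ℂ] W N :=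
  UniversalEnvelopingAlgebra.lift ℂ
    (slotSum (((piM N : U N →ₐ[ℂ] M N) : U N →ₗ⁅ℂ⁆ M N).comp (incl N)) m)

/-- The dilation maps, indexed from `0`: `j n` uses the first `n + 1` slots and belongs to
the time `t n`. -/
def j (N n : ℕ) : U N →ₐ[ℂ] W N := tensorPi N (n + 1)

/-! ## Notions of non-commutative probability -/

/-- A state on a unital `*`-algebra. -/
structure IsState {A : Type} [Ring A] [StarRing A] [Algebra ℂ A] (φ : A →ₗ[ℂ] ℂ) : Prop where
  map_one : φ 1 = 1
  im_eq_zero : ∀ a, (φ (star a * a)).im = 0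
  re_nonneg : ∀ a, 0 ≤ (φ (star a * a)).re

/-- Complete positivity of a linear map of `*`-algebras: applied entrywise, it sends every
`B* B` in a matrix algebra to a finite sum of elements of the same form. -/
def IsCompletelyPositive {A : Type} [Ring A] [StarRing A] [Algebra ℂ A] (Q : A →ₗ[ℂ] A) : Prop :=
  ∀ (n : ℕ) (B : Matrix (Fin n) (Fin n) A),
    (star B * B).map Q ∈
      AddSubmonoid.closure (Set.range fun C : Matrix (Fin n) (Fin n) A => star C * C)

/-- A non-commutative Markov operator in continuous time: a semigroup of completely positive unital
linear maps. -/
structure IsMarkov {A : Type} [Ring A] [StarRing A] [Algebra ℂ A] (Q : ℝ → A →ₗ[ℂ] A) : Prop where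
  unital : ∀ t, 0 ≤ t → Q t 1 = 1
  completelyPositive : ∀ t, 0 ≤ t → IsCompletelyPositive (Q t)
  semigroup : ∀ t s, 0 ≤ t → 0 ≤ s → Q (t + s) = Q t ∘ₗ Q s

/-- The subalgebra generated by the images of `J 0, …, J n`. -/
def past {A B : Type} [Ring A] [Algebra ℂ A] [Ring B] [Algebra ℂ B] (J : ℕ → A →ₐ[ℂ] B) (n : ℕ) :
    Subalgebra ℂ B :=
  Algebra.adjoin ℂ (⋃ m ∈ Finset.range (n + 1), Set.range (J m))

/-- The morphisms `J n` (at the times `t n`) into `(B, ω)` form a dilation of `Q`. -/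
structure IsDilation {A B : Type} [Ring A] [Algebra ℂ A] [Ring B] [StarRing B]
    [Algebra ℂ B] (Q : ℝ → A →ₗ[ℂ] A) (t : ℕ → ℝ) (J : ℕ → A →ₐ[ℂ] B) (ω : B →ₗ[ℂ] ℂ) :
    Prop where
  isState : IsState ω
  markov : ∀ (n : ℕ) (x : A), ∀ w ∈ past J n,
    ω (J (n + 1) x * w) = ω (J n (Q (t (n + 1) - t n) x) * w)

end NCWalk

end

/-! The proof rests on the identity `κ_t(g) = ∑_k w_k (Tr g)^k` with the Poisson-type weights
`w_k = e^{-tN} t^k / k!`. The function `(Tr g)^k` is the character of the `k`-th tensor power of the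
standard representation of `U(N)`, and this power is an orthogonal sum of irreducible
representations (`URep.nonempty_decomp`). By orthogonality of characters
(`integral_character_mul_star`) the coefficient of `κ_t` at a class `l`, divided by the dimension of
`l`, is therefore `∑_k w_k m_{k,l}`, where `m_{k,l} ≥ 0` is the multiplicity of `l` in the `k`-th
power (`tsum_weight_fiber`).

Convergence: an element of `gl_N` acts on the `k`-th power by an operator of norm `O(k)`, so every
operator in `M` is bounded on the constituents of that power by a polynomial in `k`
(`polyGrowth_M`), and the weights `w_k N^k` are summable against polynomials. Hence
`κ_t(T)` is an absolutely convergent sum over the constituents of all tensor powers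
(`hasSum_kappa_piece`) with nonnegative coefficients, which makes it a state; on the enveloping
algebra it is `⟨X⟩_t = ∑_k w_k Tr(X | (ℂ^N)^{⊗ k})` (`hasSum_bracket`).

From this formula everything about `P_t` follows algebraically. Traces of tensor powers satisfy
`tr_{k+m} = (tr_k ⊗ tr_m) ∘ Δ`, so the binomial theorem gives
`⟨·⟩_{r+s} = (⟨·⟩_r ⊗ ⟨·⟩_s) ∘ Δ` (`bracket_convOp`), and coassociativity turns this into the
semigroup law. Invariance under `Ad(g)` and the trace property of `⟨·⟩_t` give the two statements on
invariants and on the centre (`convOp_Ad`, `convOp_mem_center`). Complete positivity holds for the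
convolution by any state, because the Gram matrix `φ(y_a* y_b)` of the right tensor factors of a
coproduct has the form `L* L` (`isCompletelyPositive_convOp`).

For the dilation, `j_{n+1} = (j_n ⊗ slot_{n+1} ∘ π) ∘ Δ` (`j_succ`), and the product functional is
multiplicative in a new slot, so integrating out the last increment replaces `j_{n+1}(X)` by
`j_n(P X)` (`omega_mul_j_succ_mul`). Positivity of the product functional is the Schur product
theorem for Gram matrices (`prodFunctional_nonneg`). -/

noncomputable section

namespace NCWalk

attribute [local instance 100] LieRing.ofAssociativeRing

/-! ### Unitary representations and their differentials -/

section

open Matrix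

/-- A continuous unitary matrix representation of `U(N)` on `ℂ^ι`, not necessarily irreducible,
together with its differential. -/
structure URep (N : ℕ) (ι : Type) [Fintype ι] [DecidableEq ι] where
  rho : G N →* Matrix.unitaryGroup ι ℂ
  continuous_rho : Continuous rho
  drho : gl N →ₗ⁅ℂ⁆ Matrix ι ι ℂ
  rho_exp : ∀ (A : gl N) (g : G N), star A = -A → (g : gl N) = NormedSpace.exp A →
    (rho g : Matrix ι ι ℂ) = NormedSpace.exp (drho A)

/-- An irreducible representation, with irreducibility forgotten. -/
def Irrep.toURep {N : ℕ} (V : Irrep N) : URep N (Fin V.dim) :=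
  ⟨V.rho, V.continuous_rho, V.drho, V.rho_exp⟩

section Exp

variable {ι κ : Type} [Fintype ι] [DecidableEq ι] [Fintype κ] [DecidableEq κ]

open scoped Matrix.Norms.L2Operator in
theorem exp_mem_unitaryGroup {A : Matrix ι ι ℂ} (hA : star A = -A) :
    NormedSpace.exp A ∈ Matrix.unitaryGroup ι ℂ :=
  letI : NormedAlgebra ℚ (Matrix ι ι ℂ) := NormedAlgebra.restrictScalars ℚ ℂ _
  NormedSpace.exp_mem_unitary_of_mem_skewAdjoint (skewAdjoint.mem_iff.2 hA)

open scoped Matrix.Norms.L2Operator in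
theorem hasDerivAt_exp_smul_zero (A : Matrix ι ι ℂ) :
    HasDerivAt (fun s : ℝ => NormedSpace.exp (s • A)) A 0 := by
  simpa using hasDerivAt_exp_smul_const (𝕂 := ℝ) A (0 : ℝ)

/-- A matrix which intertwines two one-parameter groups intertwines their generators. -/
theorem mul_eq_mul_of_exp (S : Matrix κ ι ℂ) (X : Matrix ι ι ℂ) (Y : Matrix κ κ ℂ)
    (h : ∀ s : ℝ, S * NormedSpace.exp (s • X) = NormedSpace.exp (s • Y) * S) :
    S * X = Y * S := by
  open scoped Matrix.Norms.L2Operator in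
  let f : Matrix ι ι ℂ →L[ℝ] Matrix κ ι ℂ :=
    LinearMap.toContinuousLinearMap
      { toFun := fun Z => S * Z
        map_add' := fun _ _ => Matrix.mul_add _ _ _
        map_smul' := fun c Z => by simp }
  let f' : Matrix κ κ ℂ →L[ℝ] Matrix κ ι ℂ :=
    LinearMap.toContinuousLinearMap
      { toFun := fun Z => Z * S
        map_add' := fun _ _ => Matrix.add_mul _ _ _
        map_smul' := fun c Z => by simp }
  have h1 : HasDerivAt (fun s : ℝ => f (NormedSpace.exp (s • X))) (f X) 0 :=
    f.hasFDerivAt.comp_hasDerivAt (0 : ℝ) (hasDerivAt_exp_smul_zero X)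
  have h2 : HasDerivAt (fun s : ℝ => f' (NormedSpace.exp (s • Y))) (f' Y) 0 :=
    f'.hasFDerivAt.comp_hasDerivAt (0 : ℝ) (hasDerivAt_exp_smul_zero Y)
  have h3 : (fun s : ℝ => f (NormedSpace.exp (s • X)))
      = fun s : ℝ => f' (NormedSpace.exp (s • Y)) := funext h
  rw [h3] at h1
  exact h1.unique h2

open scoped Matrix.Norms.L2Operator in
/-- Intertwiners of matrices intertwine their exponentials. -/
theorem mul_exp_eq_exp_mul {S : Matrix κ ι ℂ} {X : Matrix ι ι ℂ} {Y : Matrix κ κ ℂ}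
    (h : S * X = Y * S) : S * NormedSpace.exp X = NormedSpace.exp Y * S := by
  have hpow : ∀ n : ℕ, S * X ^ n = Y ^ n * S := by
    intro n
    induction n with
    | zero => simp
    | succ n ih => rw [pow_succ, ← Matrix.mul_assoc, ih, Matrix.mul_assoc, h, ← Matrix.mul_assoc,
        ← pow_succ]
  let f : Matrix ι ι ℂ →L[ℂ] Matrix κ ι ℂ :=
    LinearMap.toContinuousLinearMap
      { toFun := fun Z => S * Z
        map_add' := fun _ _ => Matrix.mul_add _ _ _
        map_smul' := fun c Z => by simp }
  let f' : Matrix κ κ ℂ →L[ℂ] Matrix κ ι ℂ :=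
    LinearMap.toContinuousLinearMap
      { toFun := fun Z => Z * S
        map_add' := fun _ _ => Matrix.add_mul _ _ _
        map_smul' := fun c Z => by simp }
  have h1 := (NormedSpace.exp_series_hasSum_exp' (𝕂 := ℂ) X).mapL f
  have h2 := (NormedSpace.exp_series_hasSum_exp' (𝕂 := ℂ) Y).mapL f'
  refine h1.unique ?_
  change HasSum _ (f' (NormedSpace.exp Y))
  convert h2 using 2 with n
  change S * ((_ : ℂ) • (X ^ n)) = ((_ : ℂ) • (Y ^ n)) * S
  rw [Matrix.mul_smul, Matrix.smul_mul, hpow]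

end Exp

namespace URep

variable {N : ℕ} {ι κ : Type} [Fintype ι] [DecidableEq ι] [Fintype κ] [DecidableEq κ]

/-- The elements `exp (s A)` of `U(N)`, for skew-Hermitian `A`, are represented by
`exp (s dρ(A))` in all representations at once. -/
theorem exists_rho_eq_exp_smul {A : gl N} (hA : star A = -A) (s : ℝ) :
    ∃ g : G N, ∀ (κ : Type) [Fintype κ] [DecidableEq κ] (W : URep N κ),
      (W.rho g : Matrix κ κ ℂ) = NormedSpace.exp (s • W.drho A) := by
  have hs : star (s • A) = -(s • A) := by rw [star_smul, hA]; simp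
  refine ⟨⟨_, exp_mem_unitaryGroup hs⟩, fun κ _ _ W => ?_⟩
  rw [W.rho_exp (s • A) ⟨_, exp_mem_unitaryGroup hs⟩ hs rfl]
  congr 1
  have h1 : s • A = (s : ℂ) • A := by ext; simp
  have h2 : s • W.drho A = (s : ℂ) • W.drho A := by ext; simp
  rw [h1, h2, map_smul]

/-- Complex-linear identities on `gl_N` need only be checked on skew-Hermitian matrices. -/
theorem gl_induction {E : Type} [AddCommGroup E] [Module ℂ E] {f f' : gl N →ₗ[ℂ] E}
    (h : ∀ A : gl N, star A = -A → f A = f' A) : f = f' := by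
  ext1 A
  have h1 : star (A - star A) = -(A - star A) := by simp
  have h2 : star (Complex.I • (A + star A)) = -(Complex.I • (A + star A)) := by
    simp [star_smul, add_comm]
  have hA : A = (1 / 2 : ℂ) • (A - star A) + (-(Complex.I / 2)) • (Complex.I • (A + star A)) := by
    rw [smul_smul]
    have : -(Complex.I / 2) * Complex.I = 1 / 2 := by
      linear_combination (-1 / 2 : ℂ) * Complex.I_mul_I
    rw [this, ← smul_add, sub_add_add_cancel, ← two_smul ℂ A, smul_smul]
    norm_num
  rw [hA, map_add, map_smul, map_smul _ _ (Complex.I • (A + star A)), h _ h1, h _ h2, ← map_smul,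
    ← map_smul _ _ (Complex.I • (A + star A)), ← map_add]

/-- A matrix which intertwines two representations of `U(N)` intertwines their differentials. -/
theorem mul_drho (V : URep N ι) (W : URep N κ) {S : Matrix κ ι ℂ}
    (h : ∀ g : G N, S * (V.rho g : Matrix ι ι ℂ) = (W.rho g : Matrix κ κ ℂ) * S) (A : gl N) :
    S * V.drho A = W.drho A * S := by
  let f : gl N →ₗ[ℂ] Matrix κ ι ℂ :=
    { toFun := fun A => S * V.drho A
      map_add' := fun A B => by rw [map_add, Matrix.mul_add]
      map_smul' := fun c A => by simp }
  let f' : gl N →ₗ[ℂ] Matrix κ ι ℂ :=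
    { toFun := fun A => W.drho A * S
      map_add' := fun A B => by rw [map_add, Matrix.add_mul]
      map_smul' := fun c A => by simp }
  have hff : f = f' := gl_induction fun A hA => by
    refine mul_eq_mul_of_exp S _ _ fun s => ?_
    obtain ⟨g, hg⟩ := exists_rho_eq_exp_smul hA s
    rw [← hg ι V, ← hg κ W, h]
  exact congrArg (fun F => F A) hff

theorem star_rho (V : URep N ι) (g : G N) :
    star (V.rho g : Matrix ι ι ℂ) = (V.rho g⁻¹ : Matrix ι ι ℂ) := by
  rw [map_inv]; rfl

/-- The differential of a unitary representation is a `*`-map, as it sends skew-Hermitian matrices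
to generators of unitary one-parameter groups. -/
theorem drho_star (V : URep N ι) (A : gl N) : V.drho (star A) = star (V.drho A) := by
  have key : ∀ A : gl N, star A = -A → star (V.drho A) = -V.drho A := by
    intro A hA
    have := mul_eq_mul_of_exp (1 : Matrix ι ι ℂ) (star (V.drho A)) (-V.drho A) fun s => by
      obtain ⟨g, hg'⟩ := exists_rho_eq_exp_smul hA s
      have hg := hg' ι V
      have h1 : NormedSpace.exp (s • star (V.drho A)) = star (V.rho g : Matrix ι ι ℂ) := by
        have : s • star (V.drho A) = (s • V.drho A)ᴴ := by
          rw [← star_eq_conjTranspose, star_smul]; simp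
        rw [hg, this, Matrix.exp_conjTranspose]; rfl
      have h2 : NormedSpace.exp (s • -V.drho A) = star (V.rho g : Matrix ι ι ℂ) := by
        rw [smul_neg, Matrix.exp_neg, ← hg]
        exact Matrix.inv_eq_left_inv (Unitary.coe_star_mul_self (V.rho g))
      rw [h1, h2, Matrix.one_mul, Matrix.mul_one]
    simpa using this
  have h1 := key (A - star A) (by simp)
  have h2 := key (Complex.I • (A + star A)) (by simp [star_smul, add_comm])
  rw [map_sub, star_sub] at h1
  rw [map_smul, map_add, star_smul, star_add] at h2
  have h3 : star (V.drho A) + star (V.drho (star A)) = V.drho A + V.drho (star A) := by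
    refine smul_right_injective _ (neg_ne_zero.2 Complex.I_ne_zero) ?_
    rw [add_comm (V.drho A)]
    simpa using h2
  have h5 : (2 : ℂ) • V.drho (star A) = (2 : ℂ) • star (V.drho A) := by
    rw [two_smul, two_smul]
    calc V.drho (star A) + V.drho (star A)
        = (V.drho A + V.drho (star A)) + -(V.drho A - V.drho (star A)) := by abel
      _ = star (V.drho A) + star (V.drho A) := by rw [← h1, ← h3]; abel
  exact smul_right_injective _ two_ne_zero h5

end URep

end

section

open Matrix

/-! ### Schur's lemma -/

/-- An intertwiner of an irreducible representation with itself is scalar. -/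
theorem Irrep.exists_eq_smul_one {N : ℕ} (V : Irrep N) (S : Matrix (Fin V.dim) (Fin V.dim) ℂ)
    (h : ∀ g : G N, S * (V.rho g : Matrix (Fin V.dim) (Fin V.dim) ℂ)
      = (V.rho g : Matrix (Fin V.dim) (Fin V.dim) ℂ) * S) : ∃ c : ℂ, S = c • 1 := by
  have : Nonempty (Fin V.dim) := ⟨⟨0, V.dim_pos⟩⟩
  obtain ⟨c, hc⟩ := Module.End.exists_eigenvalue (Matrix.toLin' S)
  refine ⟨c, ?_⟩
  have hp := V.irreducible (Module.End.eigenspace (Matrix.toLin' S) c) fun g v hv => by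
    rw [Module.End.mem_eigenspace_iff, Matrix.toLin'_apply] at hv ⊢
    rw [Matrix.mulVec_mulVec, h, ← Matrix.mulVec_mulVec, hv, Matrix.mulVec_smul]
  rcases hp with hp | hp
  · exact absurd hp hc
  · refine Matrix.toLin'.injective (LinearMap.ext fun v => ?_)
    have : v ∈ Module.End.eigenspace (Matrix.toLin' S) c := hp ▸ Submodule.mem_top
    rw [Module.End.mem_eigenspace_iff] at this
    rw [this]; simp

/-- There are no nonzero intertwiners between inequivalent irreducible representations. -/
theorem Irrep.eq_zero_of_not_equiv {N : ℕ} {V W : Irrep N} (hVW : ¬ V.Equiv W)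
    (S : Matrix (Fin W.dim) (Fin V.dim) ℂ)
    (h : ∀ g : G N, S * (V.rho g : Matrix (Fin V.dim) (Fin V.dim) ℂ)
      = (W.rho g : Matrix (Fin W.dim) (Fin W.dim) ℂ) * S) : S = 0 := by
  by_contra hS
  have hS' : Matrix.toLin' S ≠ 0 := fun h0 => hS (by simpa using h0)
  have hker : LinearMap.ker (Matrix.toLin' S) = ⊥ := by
    refine (V.irreducible _ fun g v hv => ?_).resolve_right
      fun ht => hS' (LinearMap.ker_eq_top.1 ht)
    rw [LinearMap.mem_ker, Matrix.toLin'_apply] at hv ⊢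
    rw [Matrix.mulVec_mulVec, h, ← Matrix.mulVec_mulVec, hv, Matrix.mulVec_zero]
  have hran : LinearMap.range (Matrix.toLin' S) = ⊤ := by
    refine (W.irreducible _ fun g v hv => ?_).resolve_left
      fun ht => hS' (LinearMap.range_eq_bot.1 ht)
    obtain ⟨w, rfl⟩ := hv
    refine ⟨(V.rho g : Matrix (Fin V.dim) (Fin V.dim) ℂ) *ᵥ w, ?_⟩
    rw [Matrix.toLin'_apply, Matrix.toLin'_apply, Matrix.mulVec_mulVec, h, ← Matrix.mulVec_mulVec]
  refine hVW ⟨LinearEquiv.ofBijective (Matrix.toLin' S)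
    ⟨LinearMap.ker_eq_bot.1 hker, LinearMap.range_eq_top.1 hran⟩, fun g v => ?_⟩
  change Matrix.toLin' S _ = _ *ᵥ (Matrix.toLin' S v)
  rw [Matrix.toLin'_apply, Matrix.toLin'_apply, Matrix.mulVec_mulVec, h, ← Matrix.mulVec_mulVec]

/-! ### Complete reducibility -/

/-- The range of an isometry: every subspace of `ℂ^ι` has an orthonormal basis, whose vectors are
the columns of an isometry `J`, and `J Jᴴ` is the orthogonal projection. -/
theorem exists_isometry {ι : Type} [Fintype ι] [DecidableEq ι]
    (p : Submodule ℂ (EuclideanSpace ℂ ι)) :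
    ∃ J : Matrix ι (Fin (Module.finrank ℂ p)) ℂ, Jᴴ * J = 1 ∧
      ∀ v : EuclideanSpace ℂ ι, (J * Jᴴ) *ᵥ v.ofLp = (p.starProjection v).ofLp := by
  let b := stdOrthonormalBasis ℂ p
  have hJ : ∀ (v : EuclideanSpace ℂ ι) (a : Fin (Module.finrank ℂ p)),
      ((Matrix.of fun i a => (b a : EuclideanSpace ℂ ι).ofLp i)ᴴ *ᵥ v.ofLp) a
        = inner ℂ (b a : EuclideanSpace ℂ ι) v := by
    intro v a
    simp [Matrix.mulVec, dotProduct, PiLp.inner_apply, mul_comm]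
  refine ⟨Matrix.of fun i a => (b a : EuclideanSpace ℂ ι).ofLp i, ?_, fun v => ?_⟩
  · ext a a'
    have h1 := hJ (b a') a
    have h2 := orthonormal_iff_ite.1 b.orthonormal a a'
    rw [Matrix.mul_apply]
    rw [Matrix.mulVec, dotProduct] at h1
    rw [Matrix.one_apply, ← h2]
    exact h1
  · ext i
    rw [← Matrix.mulVec_mulVec, Matrix.mulVec, dotProduct]
    simp only [hJ]
    have h3 := b.orthogonalProjectionOnto_apply_eq_sum v
    have h4 : p.starProjection v = ∑ a, inner ℂ (b a : EuclideanSpace ℂ ι) v •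
        (b a : EuclideanSpace ℂ ι) := by
      have := congrArg (fun x : p => (x : EuclideanSpace ℂ ι)) h3
      simpa using this
    rw [h4]
    simp [mul_comm]

namespace URep

variable {N : ℕ} {ι κ : Type} [Fintype ι] [DecidableEq ι] [Fintype κ] [DecidableEq κ]

/-- The subrepresentation carried by the range of an isometry `J`. -/
def restrict (V : URep N ι) (J : Matrix ι κ ℂ) (hJ : Jᴴ * J = 1)
    (hc : ∀ g, (J * Jᴴ) * (V.rho g : Matrix ι ι ℂ) = (V.rho g : Matrix ι ι ℂ) * (J * Jᴴ)) :
    URep N κ :=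
  have hmul : ∀ A B : Matrix ι ι ℂ, (J * Jᴴ) * A = A * (J * Jᴴ) →
      Jᴴ * (A * B) * J = (Jᴴ * A * J) * (Jᴴ * B * J) := fun A B hA => by
    calc Jᴴ * (A * B) * J = (Jᴴ * J) * Jᴴ * (A * B) * J := by rw [hJ, Matrix.one_mul]
      _ = Jᴴ * ((J * Jᴴ) * A) * B * J := by simp only [Matrix.mul_assoc]
      _ = _ := by rw [hA]; simp only [Matrix.mul_assoc]
  have hd : ∀ A, (J * Jᴴ) * V.drho A = V.drho A * (J * Jᴴ) := V.mul_drho V hc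
  have hunit : ∀ g h : G N, g * h = 1 → (Jᴴ * (V.rho g : Matrix ι ι ℂ) * J) *
      (Jᴴ * (V.rho h : Matrix ι ι ℂ) * J) = 1 := fun g h hgh => by
    have h1 : (V.rho g : Matrix ι ι ℂ) * (V.rho h : Matrix ι ι ℂ) = 1 := by
      have := congrArg (fun x => (V.rho x : Matrix ι ι ℂ)) hgh
      simpa using this
    rw [← hmul _ _ (hc g), h1, Matrix.mul_one, hJ]
  have hstar : ∀ g : G N, star (Jᴴ * (V.rho g : Matrix ι ι ℂ) * J)
      = Jᴴ * (V.rho g⁻¹ : Matrix ι ι ℂ) * J := fun g => by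
    rw [← V.star_rho]
    simp only [star_eq_conjTranspose, conjTranspose_mul, conjTranspose_conjTranspose,
      Matrix.mul_assoc]
  { rho :=
      { toFun := fun g => ⟨Jᴴ * (V.rho g : Matrix ι ι ℂ) * J, by
          rw [Unitary.mem_iff, hstar]
          exact ⟨hunit _ _ (inv_mul_cancel g), hunit _ _ (mul_inv_cancel g)⟩⟩
        map_one' := Subtype.ext (by simp [hJ])
        map_mul' := fun g h => Subtype.ext (by
          change Jᴴ * (V.rho (g * h) : Matrix ι ι ℂ) * J = _ * _
          rw [map_mul]
          exact hmul _ _ (hc g)) }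
    continuous_rho := by
      refine Continuous.subtype_mk ?_ _
      have := V.continuous_rho
      fun_prop
    drho :=
      { toFun := fun A => Jᴴ * V.drho A * J
        map_add' := fun A B => by rw [map_add, Matrix.mul_add, Matrix.add_mul]
        map_smul' := fun c A => by simp
        map_lie' := fun {A B} => by
          rw [LieHom.map_lie, LieRing.of_associative_ring_bracket,
            LieRing.of_associative_ring_bracket, Matrix.mul_sub, Matrix.sub_mul,
            hmul _ _ (hd A), hmul _ _ (hd B)] }
    rho_exp := fun A g hA hg => by
      change Jᴴ * (V.rho g : Matrix ι ι ℂ) * J = NormedSpace.exp (Jᴴ * V.drho A * J)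
      have h1 : J * (Jᴴ * V.drho A * J) = V.drho A * J := by
        calc J * (Jᴴ * V.drho A * J) = (J * Jᴴ) * V.drho A * J := by simp only [Matrix.mul_assoc]
          _ = V.drho A * J * (Jᴴ * J) := by rw [hd]; simp only [Matrix.mul_assoc]
          _ = _ := by rw [hJ, Matrix.mul_one]
      rw [V.rho_exp A g hA hg, Matrix.mul_assoc, ← mul_exp_eq_exp_mul h1, ← Matrix.mul_assoc, hJ,
        Matrix.one_mul] }

theorem rho_mul_restrict (V : URep N ι) (J : Matrix ι κ ℂ) (hJ : Jᴴ * J = 1)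
    (hc : ∀ g, (J * Jᴴ) * (V.rho g : Matrix ι ι ℂ) = (V.rho g : Matrix ι ι ℂ) * (J * Jᴴ))
    (g : G N) : (V.rho g : Matrix ι ι ℂ) * J
      = J * ((V.restrict J hJ hc).rho g : Matrix κ κ ℂ) := by
  change _ = J * (Jᴴ * (V.rho g : Matrix ι ι ℂ) * J)
  calc (V.rho g : Matrix ι ι ℂ) * J = (V.rho g : Matrix ι ι ℂ) * J * (Jᴴ * J) := by
        rw [hJ, Matrix.mul_one]
    _ = ((V.rho g : Matrix ι ι ℂ) * (J * Jᴴ)) * J := by simp only [Matrix.mul_assoc]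
    _ = _ := by rw [← hc]; simp only [Matrix.mul_assoc]

/-- An orthogonal decomposition of a representation into irreducible ones, each of which is the
chosen representative of its class and is embedded by an isometry. -/
structure Decomp (V : URep N ι) where
  index : Type
  fintype : Fintype index
  cls : index → Dual N
  iso : ∀ a, Matrix ι (Fin (rep (cls a)).dim) ℂ
  isometry : ∀ a, (iso a)ᴴ * iso a = 1
  sum_eq_one : ∑ a, iso a * (iso a)ᴴ = 1
  rho_mul : ∀ a g, (V.rho g : Matrix ι ι ℂ) * iso a
    = iso a * ((rep (cls a)).rho g : Matrix (Fin (rep (cls a)).dim) (Fin (rep (cls a)).dim) ℂ)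

attribute [instance] Decomp.fintype

/-- Decompositions of complementary subrepresentations form one of the whole. -/
def Decomp.glue {V : URep N ι} {β : Type} [Fintype β] {d : β → ℕ} (J : ∀ b, Matrix ι (Fin (d b)) ℂ)
    (hJ : ∀ b, (J b)ᴴ * J b = 1) (hsum : ∑ b, J b * (J b)ᴴ = 1)
    (hc : ∀ b g, (J b * (J b)ᴴ) * (V.rho g : Matrix ι ι ℂ)
      = (V.rho g : Matrix ι ι ℂ) * (J b * (J b)ᴴ))
    (D : ∀ b, Decomp (V.restrict (J b) (hJ b) (hc b))) : Decomp V where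
  index := Σ b, (D b).index
  fintype := inferInstance
  cls a := (D a.1).cls a.2
  iso a := J a.1 * (D a.1).iso a.2
  isometry a := by
    rw [conjTranspose_mul, Matrix.mul_assoc, ← Matrix.mul_assoc (J a.1)ᴴ, hJ, Matrix.one_mul,
      (D a.1).isometry]
  sum_eq_one := by
    rw [Fintype.sum_sigma, ← hsum]
    refine Finset.sum_congr rfl fun b _ => ?_
    calc ∑ a, J b * (D b).iso a * (J b * (D b).iso a)ᴴ
        = J b * (∑ a, (D b).iso a * ((D b).iso a)ᴴ) * (J b)ᴴ := by
          rw [Matrix.mul_sum, Matrix.sum_mul]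
          exact Finset.sum_congr rfl fun a _ => by simp only [conjTranspose_mul, Matrix.mul_assoc]
      _ = _ := by rw [(D b).sum_eq_one, Matrix.mul_one]
  rho_mul a g := by
    rw [← Matrix.mul_assoc, rho_mul_restrict V _ (hJ a.1) (hc a.1), Matrix.mul_assoc,
      (D a.1).rho_mul, Matrix.mul_assoc]

open scoped ComplexOrder in
/-- An irreducible representation is unitarily equivalent to the chosen representative of its
class. -/
theorem Decomp.of_irreducible {d : ℕ} (V : URep N (Fin d)) (hd : 0 < d)
    (hirr : ∀ p : Submodule ℂ (Fin d → ℂ),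
      (∀ g : G N, ∀ v ∈ p, Matrix.mulVec (V.rho g : Matrix (Fin d) (Fin d) ℂ) v ∈ p) →
        p = ⊥ ∨ p = ⊤) : Nonempty (Decomp V) := by
  let W : Irrep N := ⟨d, hd, V.rho, V.continuous_rho, V.drho, V.rho_exp, hirr⟩
  let l : Dual N := ⟦W⟧
  obtain ⟨S, hS⟩ : Irrep.Equiv (rep l) W := Quotient.exact (Quotient.out_eq l)
  let B : Matrix (Fin d) (Fin (rep l).dim) ℂ := LinearMap.toMatrix' S.toLinearMap
  let T : Matrix (Fin (rep l).dim) (Fin d) ℂ := LinearMap.toMatrix' S.symm.toLinearMap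
  have hBT : B * T = 1 := by
    rw [← LinearMap.toMatrix'_comp]; simp
  have hTB : T * B = 1 := by
    rw [← LinearMap.toMatrix'_comp]; simp
  have hB : ∀ g, B * ((rep l).rho g : Matrix (Fin (rep l).dim) (Fin (rep l).dim) ℂ)
      = (V.rho g : Matrix (Fin d) (Fin d) ℂ) * B := by
    intro g
    refine Matrix.toLin'.injective (LinearMap.ext fun v => ?_)
    rw [Matrix.toLin'_mul, Matrix.toLin'_mul]
    simpa [B, LinearMap.toMatrix'_mulVec] using hS g v
  -- `Bᴴ B` is a positive scalar by Schur's lemma, so `B` is a multiple of a unitary.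
  have hB' : ∀ g, Bᴴ * (V.rho g : Matrix (Fin d) (Fin d) ℂ)
      = ((rep l).rho g : Matrix (Fin (rep l).dim) (Fin (rep l).dim) ℂ) * Bᴴ := by
    intro g
    have := congrArg conjTranspose (hB g⁻¹)
    rw [conjTranspose_mul, conjTranspose_mul, ← star_eq_conjTranspose,
      ← star_eq_conjTranspose (V.rho g⁻¹ : Matrix (Fin d) (Fin d) ℂ), V.star_rho,
      show star ((rep l).rho g⁻¹ : Matrix (Fin (rep l).dim) (Fin (rep l).dim) ℂ)
        = (rep l).rho g⁻¹⁻¹ from (rep l).toURep.star_rho _, inv_inv] at this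
    exact this.symm
  obtain ⟨c, hc⟩ := (rep l).exists_eq_smul_one (Bᴴ * B) fun g => by
    rw [Matrix.mul_assoc, hB, ← Matrix.mul_assoc, hB', Matrix.mul_assoc]
  have hpos : 0 < c := by
    have hpd : (Bᴴ * B).PosDef := Matrix.PosDef.conjTranspose_mul_self B fun v w hvw => by
      have := congrArg (fun x => T *ᵥ x) hvw
      simpa [Matrix.mulVec_mulVec, hTB] using this
    rw [hc] at hpd
    have := hpd.diag_pos (i := ⟨0, (rep l).dim_pos⟩)
    simpa using this
  obtain ⟨r, hr, rfl⟩ : ∃ r : ℝ, 0 < r ∧ (r : ℂ) = c :=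
    ⟨c.re, (Complex.pos_iff.1 hpos).1, Complex.ext rfl (Complex.pos_iff.1 hpos).2⟩
  have hs : (Real.sqrt r : ℂ) ≠ 0 := by exact_mod_cast (Real.sqrt_pos.2 hr).ne'
  have hs2 : (Real.sqrt r : ℂ) * Real.sqrt r = r := by exact_mod_cast Real.mul_self_sqrt hr.le
  have hiso : ((Real.sqrt r : ℂ)⁻¹ • B)ᴴ * ((Real.sqrt r : ℂ)⁻¹ • B) = 1 := by
    rw [conjTranspose_smul, Matrix.smul_mul, Matrix.mul_smul, hc, smul_smul, smul_smul, ← hs2]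
    have : star ((Real.sqrt r : ℂ)⁻¹) = (Real.sqrt r : ℂ)⁻¹ := by simp
    rw [this, ← one_smul ℂ (1 : Matrix (Fin (rep l).dim) (Fin (rep l).dim) ℂ), smul_smul]
    congr 1
    field_simp
  have hinv : ((Real.sqrt r : ℂ)⁻¹ • B) * ((Real.sqrt r : ℂ) • T) = 1 := by
    rw [Matrix.smul_mul, Matrix.mul_smul, smul_smul, inv_mul_cancel₀ hs, one_smul, hBT]
  refine ⟨⟨Unit, inferInstance, fun _ => l, fun _ => (Real.sqrt r : ℂ)⁻¹ • B, fun _ => hiso, ?_,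
    fun _ g => ?_⟩⟩
  · have h1 : ((Real.sqrt r : ℂ)⁻¹ • B)ᴴ = (Real.sqrt r : ℂ) • T := by
      calc ((Real.sqrt r : ℂ)⁻¹ • B)ᴴ = ((Real.sqrt r : ℂ)⁻¹ • B)ᴴ *
            (((Real.sqrt r : ℂ)⁻¹ • B) * ((Real.sqrt r : ℂ) • T)) := by rw [hinv, Matrix.mul_one]
        _ = _ := by rw [← Matrix.mul_assoc, hiso, Matrix.one_mul]
    rw [Fintype.sum_unique, h1, hinv]
  · rw [Matrix.mul_smul, Matrix.smul_mul, hB]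

/-- Unitary representations are completely reducible: an invariant subspace and its orthogonal
complement are the ranges of isometries whose range projections commute with the group. -/
theorem nonempty_decomp_fin (d : ℕ) (V : URep N (Fin d)) : Nonempty (Decomp V) := by
  induction d using Nat.strong_induction_on with
  | _ d ih =>
  rcases Nat.eq_zero_or_pos d with rfl | hd
  · exact ⟨⟨Empty, inferInstance, fun a => a.elim, fun a => a.elim, fun a => a.elim,
      Subsingleton.elim _ _, fun a => a.elim⟩⟩
  by_cases hirr : ∀ p : Submodule ℂ (Fin d → ℂ),
      (∀ g : G N, ∀ v ∈ p, Matrix.mulVec (V.rho g : Matrix (Fin d) (Fin d) ℂ) v ∈ p) →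
        p = ⊥ ∨ p = ⊤
  · exact Decomp.of_irreducible V hd hirr
  push Not at hirr
  obtain ⟨p', hp', hbot', htop'⟩ := hirr
  let e := WithLp.linearEquiv 2 ℂ (Fin d → ℂ)
  let p : Submodule ℂ (EuclideanSpace ℂ (Fin d)) := p'.comap e.toLinearMap
  have hp : ∀ g : G N, ∀ v ∈ p,
      WithLp.toLp 2 ((V.rho g : Matrix (Fin d) (Fin d) ℂ) *ᵥ v.ofLp) ∈ p :=
    fun g v hv => hp' g _ hv
  have hbot : p ≠ ⊥ := fun h => hbot' (by
    rw [eq_bot_iff]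
    intro v hv
    have : e.symm v ∈ p := by simpa [p] using hv
    rw [h, Submodule.mem_bot] at this
    simpa using this)
  have htop : p ≠ ⊤ := fun h => htop' (by
    rw [eq_top_iff]
    intro v _
    have : e.symm v ∈ p := h ▸ Submodule.mem_top
    simpa [p] using this)
  obtain ⟨J, hJ, hJp⟩ := exists_isometry p
  obtain ⟨K, hK, hKp⟩ := exists_isometry pᗮ
  have hJK : J * Jᴴ + K * Kᴴ = 1 := by
    refine Matrix.toLin'.injective (LinearMap.ext fun v => ?_)
    have h1 := hJp (WithLp.toLp 2 v)
    have h2 := hKp (WithLp.toLp 2 v)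
    rw [map_add, LinearMap.add_apply, Matrix.toLin'_apply, Matrix.toLin'_apply]
    have h3 : p.starProjection (WithLp.toLp 2 v) + pᗮ.starProjection (WithLp.toLp 2 v)
        = WithLp.toLp 2 v := by
      rw [← _root_.add_apply, Submodule.starProjection_orthogonal]; simp
    have h4 := congrArg WithLp.ofLp h3
    simp only [WithLp.ofLp_add] at h4
    rw [← h1, ← h2] at h4
    simpa using h4
  -- Invariance of `p`; the adjoint of this identity gives that of the orthogonal complement.
  have h1 : ∀ g, (J * Jᴴ) * (V.rho g : Matrix (Fin d) (Fin d) ℂ) * (J * Jᴴ)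
      = (V.rho g : Matrix (Fin d) (Fin d) ℂ) * (J * Jᴴ) := fun g => by
    refine Matrix.toLin'.injective (LinearMap.ext fun v => ?_)
    have h2 := hJp (WithLp.toLp 2 v)
    have h3 := hJp (WithLp.toLp 2 ((V.rho g : Matrix (Fin d) (Fin d) ℂ) *ᵥ
      (p.starProjection (WithLp.toLp 2 v)).ofLp))
    simp only at h2 h3
    rw [Matrix.toLin'_apply, Matrix.toLin'_apply, ← Matrix.mulVec_mulVec v (_ * _),
      ← Matrix.mulVec_mulVec v _ (J * Jᴴ), ← Matrix.mulVec_mulVec _ (J * Jᴴ), h2, h3, Submodule.starProjection_eq_self_iff.2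
      (hp g _ (Submodule.starProjection_apply_mem p _))]
  have hcJ : ∀ g, (J * Jᴴ) * (V.rho g : Matrix (Fin d) (Fin d) ℂ)
      = (V.rho g : Matrix (Fin d) (Fin d) ℂ) * (J * Jᴴ) := fun g => by
    have h2 := congrArg conjTranspose (h1 g⁻¹)
    have h3 : ((V.rho g⁻¹ : Matrix (Fin d) (Fin d) ℂ))ᴴ = (V.rho g : Matrix (Fin d) (Fin d) ℂ) := by
      rw [← star_eq_conjTranspose, V.star_rho, inv_inv]
    simp only [conjTranspose_mul, conjTranspose_conjTranspose, h3] at h2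
    rw [← h2, ← Matrix.mul_assoc, h1 g]
  have hcK : ∀ g, (K * Kᴴ) * (V.rho g : Matrix (Fin d) (Fin d) ℂ)
      = (V.rho g : Matrix (Fin d) (Fin d) ℂ) * (K * Kᴴ) := fun g => by
    rw [← eq_sub_iff_add_eq'] at hJK
    rw [hJK, Matrix.sub_mul, Matrix.mul_sub, hcJ, Matrix.one_mul, Matrix.mul_one]
  have hlt : Module.finrank ℂ p < d := by
    simpa using Submodule.finrank_lt htop
  have hlt' : Module.finrank ℂ pᗮ < d := by
    have hadd := p.finrank_add_finrank_orthogonal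
    have : Module.finrank ℂ p ≠ 0 := fun h => hbot (Submodule.finrank_eq_zero.1 h)
    rw [finrank_euclideanSpace_fin] at hadd
    omega
  obtain ⟨DJ⟩ := ih _ hlt (V.restrict J hJ hcJ)
  obtain ⟨DK⟩ := ih _ hlt' (V.restrict K hK hcK)
  exact ⟨Decomp.glue (β := Bool) (V := V)
    (d := fun b => match b with | true => Module.finrank ℂ p | false => Module.finrank ℂ pᗮ)
    (fun b => match b with | true => J | false => K)
    (fun b => match b with | true => hJ | false => hK) (by simpa using hJK)
    (fun b => match b with | true => hcJ | false => hcK)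
    (fun b => match b with | true => DJ | false => DK)⟩

/-- The permutation matrix of a bijection of index types. -/
def permMatrix (e : κ ≃ ι) : Matrix ι κ ℂ := (1 : Matrix ι ι ℂ).submatrix id e

omit [DecidableEq κ] in
theorem permMatrix_mul_conjTranspose (e : κ ≃ ι) : permMatrix e * (permMatrix e)ᴴ = 1 := by
  rw [permMatrix, conjTranspose_submatrix, Matrix.submatrix_mul_equiv]; simp

omit [Fintype κ] [DecidableEq κ] in
theorem permMatrix_conjTranspose_mul_mul (e : κ ≃ ι) (A : Matrix ι ι ℂ) :
    (permMatrix e)ᴴ * A * permMatrix e = A.submatrix e e := by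
  rw [permMatrix, conjTranspose_submatrix, conjTranspose_one]
  ext a b
  simp [Matrix.mul_apply, Matrix.one_apply]

omit [Fintype κ] in
theorem permMatrix_conjTranspose_mul (e : κ ≃ ι) : (permMatrix e)ᴴ * permMatrix e = 1 := by
  have := permMatrix_conjTranspose_mul_mul e (1 : Matrix ι ι ℂ)
  rwa [Matrix.mul_one, Matrix.submatrix_one_equiv] at this

omit [DecidableEq κ] in
theorem permMatrix_comm (V : URep N ι) (e : κ ≃ ι) (g : G N) :
    (permMatrix e * (permMatrix e)ᴴ) * (V.rho g : Matrix ι ι ℂ)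
      = (V.rho g : Matrix ι ι ℂ) * (permMatrix e * (permMatrix e)ᴴ) := by
  rw [permMatrix_mul_conjTranspose, Matrix.one_mul, Matrix.mul_one]

/-- Transport of a representation along a bijection of the index types. -/
def reindex (e : κ ≃ ι) (V : URep N ι) : URep N κ :=
  V.restrict (permMatrix e) (permMatrix_conjTranspose_mul e) (V.permMatrix_comm e)

theorem rho_reindex (e : κ ≃ ι) (V : URep N ι) (g : G N) :
    ((V.reindex e).rho g : Matrix κ κ ℂ) = (V.rho g : Matrix ι ι ℂ).submatrix e e :=
  permMatrix_conjTranspose_mul_mul e _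

theorem nonempty_decomp (V : URep N ι) : Nonempty (Decomp V) := by
  let e := (Fintype.equivFin ι).symm
  obtain ⟨D⟩ := nonempty_decomp_fin _ (V.reindex e)
  exact ⟨Decomp.glue (β := Unit) (fun _ => permMatrix e)
    (fun _ => permMatrix_conjTranspose_mul e) (by simpa using permMatrix_mul_conjTranspose e)
    (fun _ => V.permMatrix_comm e) (fun _ => D)⟩

end URep

end

/-! ### Tensor powers of the standard representation -/

section

open Matrix
open scoped Kronecker

section Kronecker

variable (ι κ : Type) [Fintype ι] [DecidableEq ι] [Fintype κ] [DecidableEq κ]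

/-- The embedding `A ↦ A ⊗ 1` of matrix algebras. -/
def kronLeft : Matrix ι ι ℂ →⋆ₐ[ℂ] Matrix (ι × κ) (ι × κ) ℂ where
  toFun A := A ⊗ₖ 1
  map_one' := Matrix.one_kronecker_one
  map_mul' A B := by rw [← Matrix.mul_kronecker_mul, Matrix.mul_one]
  map_zero' := Matrix.zero_kronecker _
  map_add' A B := Matrix.add_kronecker _ _ _
  commutes' c := by
    rw [Algebra.algebraMap_eq_smul_one, Matrix.smul_kronecker, Matrix.one_kronecker_one,
      Algebra.algebraMap_eq_smul_one]
  map_star' A := by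
    rw [star_eq_conjTranspose, star_eq_conjTranspose, Matrix.conjTranspose_kronecker,
      conjTranspose_one]

/-- The embedding `B ↦ 1 ⊗ B` of matrix algebras. -/
def kronRight : Matrix κ κ ℂ →⋆ₐ[ℂ] Matrix (ι × κ) (ι × κ) ℂ where
  toFun A := 1 ⊗ₖ A
  map_one' := Matrix.one_kronecker_one
  map_mul' A B := by rw [← Matrix.mul_kronecker_mul, Matrix.mul_one]
  map_zero' := Matrix.kronecker_zero _
  map_add' A B := Matrix.kronecker_add _ _ _
  commutes' c := by
    rw [Algebra.algebraMap_eq_smul_one, Matrix.kronecker_smul, Matrix.one_kronecker_one,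
      Algebra.algebraMap_eq_smul_one]
  map_star' A := by
    rw [star_eq_conjTranspose, star_eq_conjTranspose, Matrix.conjTranspose_kronecker,
      conjTranspose_one]

variable {ι κ}

theorem kronLeft_mul_kronRight (A : Matrix ι ι ℂ) (B : Matrix κ κ ℂ) :
    kronLeft ι κ A * kronRight ι κ B = A ⊗ₖ B := by
  change (A ⊗ₖ 1) * (1 ⊗ₖ B) = _
  rw [← Matrix.mul_kronecker_mul, Matrix.one_mul, Matrix.mul_one]

theorem kronRight_mul_kronLeft (A : Matrix ι ι ℂ) (B : Matrix κ κ ℂ) :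
    kronRight ι κ B * kronLeft ι κ A = A ⊗ₖ B := by
  change (1 ⊗ₖ B) * (A ⊗ₖ 1) = _
  rw [← Matrix.mul_kronecker_mul, Matrix.one_mul, Matrix.mul_one]

theorem commute_kronLeft_kronRight (A : Matrix ι ι ℂ) (B : Matrix κ κ ℂ) :
    Commute (kronLeft ι κ A) (kronRight ι κ B) :=
  (kronLeft_mul_kronRight A B).trans (kronRight_mul_kronLeft A B).symm

open scoped Matrix.Norms.L2Operator in
theorem map_exp_starAlgHom (f : Matrix ι ι ℂ →⋆ₐ[ℂ] Matrix κ κ ℂ) (A : Matrix ι ι ℂ) :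
    f (NormedSpace.exp A) = NormedSpace.exp (f A) := by
  let _ : NormedAlgebra ℚ (Matrix ι ι ℂ) := NormedAlgebra.restrictScalars ℚ ℂ _
  let _ : NormedAlgebra ℚ (Matrix κ κ ℂ) := NormedAlgebra.restrictScalars ℚ ℂ _
  exact NormedSpace.map_exp f f.toAlgHom.toLinearMap.continuous_of_finiteDimensional A

open scoped Matrix.Norms.L2Operator in
/-- `*`-homomorphisms of matrix algebras are contractive; this bounds `‖A ⊗ 1‖` and `‖1 ⊗ A‖`. -/
theorem norm_starAlgHom_le (f : Matrix ι ι ℂ →⋆ₐ[ℂ] Matrix κ κ ℂ) (A : Matrix ι ι ℂ) :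
    ‖f A‖ ≤ ‖A‖ :=
  NonUnitalStarAlgHom.norm_apply_le f A

omit [DecidableEq ι] [DecidableEq κ] in
theorem trace_submatrix (e : κ ≃ ι) (A : Matrix ι ι ℂ) :
    Matrix.trace (A.submatrix e e) = Matrix.trace A :=
  Equiv.sum_comp e fun i => A i i

open scoped Matrix.Norms.L2Operator

omit [DecidableEq ι] in
theorem norm_le_one_of_isometry {J : Matrix ι κ ℂ} (hJ : Jᴴ * J = 1) : ‖J‖ ≤ 1 := by
  have h1 : ‖(1 : Matrix κ κ ℂ)‖ ≤ 1 := by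
    rw [← Matrix.diagonal_one, Matrix.l2_opNorm_diagonal]
    exact (pi_norm_le_iff_of_nonneg zero_le_one).2 fun _ => by simp
  have h2 := Matrix.l2_opNorm_conjTranspose_mul_self J
  rw [hJ] at h2
  nlinarith [norm_nonneg J]

theorem norm_conj_isometry_le {J : Matrix ι κ ℂ} (hJ : Jᴴ * J = 1) (A : Matrix ι ι ℂ) :
    ‖Jᴴ * A * J‖ ≤ ‖A‖ := by
  have h1 := norm_le_one_of_isometry hJ
  calc ‖Jᴴ * A * J‖ ≤ ‖Jᴴ‖ * ‖A‖ * ‖J‖ :=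
        (Matrix.l2_opNorm_mul _ _).trans (by gcongr; exact Matrix.l2_opNorm_mul _ _)
    _ ≤ 1 * ‖A‖ * 1 := by
        rw [Matrix.l2_opNorm_conjTranspose]
        gcongr
    _ = ‖A‖ := by ring

theorem norm_entry_le (A : Matrix ι ι ℂ) (i j : ι) : ‖A i j‖ ≤ ‖A‖ := by
  have h1 := Matrix.l2_opNorm_mulVec A (EuclideanSpace.single j (1 : ℂ))
  have h2 := PiLp.norm_apply_le ((EuclideanSpace.equiv ι ℂ).symm
    (A *ᵥ (EuclideanSpace.single j (1 : ℂ)).ofLp)) i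
  simpa using h2.trans h1

theorem norm_trace_le (A : Matrix ι ι ℂ) : ‖Matrix.trace A‖ ≤ Fintype.card ι * ‖A‖ := by
  calc ‖∑ i, A i i‖ ≤ ∑ i : ι, ‖A‖ := norm_sum_le_of_le _ fun i _ => norm_entry_le A i i
    _ = _ := by simp

end Kronecker

namespace URep

variable {N : ℕ} {ι κ : Type} [Fintype ι] [DecidableEq ι] [Fintype κ] [DecidableEq κ]

/-- The tensor product of two representations. -/
def tensor (V : URep N ι) (W : URep N κ) : URep N (ι × κ) where
  rho :=
    { toFun := fun g => ⟨(V.rho g : Matrix ι ι ℂ) ⊗ₖ (W.rho g : Matrix κ κ ℂ),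
        Matrix.kronecker_mem_unitary (V.rho g).2 (W.rho g).2⟩
      map_one' := Subtype.ext (by simp)
      map_mul' := fun g h => Subtype.ext (by simp [Matrix.mul_kronecker_mul]) }
  continuous_rho := by
    refine Continuous.subtype_mk ?_ _
    have h1 := continuous_subtype_val.comp V.continuous_rho
    have h2 := continuous_subtype_val.comp W.continuous_rho
    exact continuous_matrix fun i j => (h1.matrix_elem i.1 j.1).mul (h2.matrix_elem i.2 j.2)
  drho :=
    { toFun := fun A => kronLeft ι κ (V.drho A) + kronRight ι κ (W.drho A)
      map_add' := fun A B => by simp only [map_add]; abel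
      map_smul' := fun c A => by simp only [map_smul, RingHom.id_apply, smul_add]
      map_lie' := fun {A B} => by
        rw [LieHom.map_lie, LieHom.map_lie]
        simp only [LieRing.of_associative_ring_bracket, map_sub, map_mul, add_mul, mul_add,
          (commute_kronLeft_kronRight _ _).eq]
        abel }
  rho_exp A g hA hg := by
    change (V.rho g : Matrix ι ι ℂ) ⊗ₖ (W.rho g : Matrix κ κ ℂ)
      = NormedSpace.exp (kronLeft ι κ (V.drho A) + kronRight ι κ (W.drho A))
    rw [Matrix.exp_add_of_commute _ _ (commute_kronLeft_kronRight _ _), ← map_exp_starAlgHom,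
      ← map_exp_starAlgHom, kronLeft_mul_kronRight, V.rho_exp A g hA hg, W.rho_exp A g hA hg]

/-- The one-dimensional trivial representation. -/
def trivial (N : ℕ) (ι : Type) [Fintype ι] [DecidableEq ι] : URep N ι where
  rho := 1
  continuous_rho := continuous_const
  drho := 0
  rho_exp _ _ _ _ := by simp

/-- The standard representation of `U(N)` on `ℂ^N`. -/
def std (N : ℕ) : URep N (Fin N) where
  rho := MonoidHom.id _
  continuous_rho := continuous_id
  drho := LieHom.id
  rho_exp _ _ _ hg := hg

/-- The tensor powers of the standard representation, on functions `Fin k → Fin N`. -/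
def tensorPow (N : ℕ) : ∀ k : ℕ, URep N (Fin k → Fin N)
  | 0 => trivial N _
  | k + 1 => ((std N).tensor (tensorPow N k)).reindex
      (Fin.consEquiv fun _ => Fin N).symm

theorem trace_rho_tensorPow (k : ℕ) (g : G N) :
    Matrix.trace ((tensorPow N k).rho g : Matrix (Fin k → Fin N) (Fin k → Fin N) ℂ)
      = Matrix.trace (g : gl N) ^ k := by
  induction k with
  | zero => simp [tensorPow, trivial]
  | succ k ih =>
    rw [tensorPow, rho_reindex, trace_submatrix, pow_succ', ← ih]
    exact Matrix.trace_kronecker _ _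

open scoped Matrix.Norms.L2Operator in
theorem norm_drho_tensorPow_le (k : ℕ) (A : gl N) : ‖(tensorPow N k).drho A‖ ≤ k * ‖A‖ := by
  induction k with
  | zero => simp [tensorPow, trivial]
  | succ k ih =>
    calc ‖(tensorPow N (k + 1)).drho A‖
        ≤ ‖kronLeft (Fin N) (Fin k → Fin N) A
            + kronRight (Fin N) (Fin k → Fin N) ((tensorPow N k).drho A)‖ :=
          norm_conj_isometry_le (permMatrix_conjTranspose_mul _) _
      _ ≤ ‖A‖ + k * ‖A‖ := (norm_add_le _ _).trans
          (add_le_add (norm_starAlgHom_le _ _) ((norm_starAlgHom_le _ _).trans ih))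
      _ = _ := by push_cast; ring

/-- The representation twisted by an inner automorphism. -/
def conj (V : URep N ι) (g : G N) : URep N ι where
  rho := V.rho.comp (MulAut.conj g).toMonoidHom
  continuous_rho := V.continuous_rho.comp (by
    change Continuous fun h : G N => g * h * g⁻¹
    fun_prop)
  drho := V.drho.comp (adGl g)
  rho_exp A h hA hh := by
    refine V.rho_exp _ _ ?_ ?_
    · change star ((g : gl N) * A * star (g : gl N)) = -((g : gl N) * A * star (g : gl N))
      rw [star_mul, star_mul, star_star, hA]
      simp [mul_assoc]
    · change (g : gl N) * h * star (g : gl N) = NormedSpace.exp ((g : gl N) * A * star (g : gl N))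
      have h1 : (g : gl N) * A = ((g : gl N) * A * star (g : gl N)) * g := by
        rw [mul_assoc _ (star (g : gl N)), Unitary.coe_star_mul_self, mul_one]
      rw [hh]
      have := mul_exp_eq_exp_mul h1
      rw [this, mul_assoc, Unitary.mul_star_self_of_mem g.2, mul_one]

/-- `ρ(g) dρ(A) ρ(g)⁻¹ = dρ(Ad(g) A)`: the matrix `ρ(g)` intertwines `ρ` with its twist by `g`. -/
theorem rho_mul_drho (V : URep N ι) (g : G N) (A : gl N) :
    (V.rho g : Matrix ι ι ℂ) * V.drho A = V.drho (adGl g A) * (V.rho g : Matrix ι ι ℂ) :=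
  V.mul_drho (V.conj g) (fun h => by
    change (V.rho g : Matrix ι ι ℂ) * V.rho h = V.rho (g * h * g⁻¹) * V.rho g
    have : V.rho (g * h * g⁻¹) * V.rho g = V.rho g * V.rho h := by
      rw [← map_mul, ← map_mul]; simp
    exact (congrArg Subtype.val this).symm) A

/-- The representation of `U(gl_N)` associated with a representation of `U(N)`. -/
def act (V : URep N ι) : U N →ₐ[ℂ] Matrix ι ι ℂ := UniversalEnvelopingAlgebra.lift ℂ V.drho

theorem act_incl (V : URep N ι) (A : gl N) : V.act (incl N A) = V.drho A :=
  UniversalEnvelopingAlgebra.lift_ι_apply ℂ _ A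

end URep

/-! ### Representations of the enveloping algebra -/

/-- Induction on the enveloping algebra, which is generated by `gl_N`. -/
theorem U_induction {N : ℕ} {p : U N → Prop} (halg : ∀ c, p (algebraMap ℂ (U N) c))
    (hincl : ∀ A, p (incl N A)) (hadd : ∀ x y, p x → p y → p (x + y))
    (hmul : ∀ x y, p x → p y → p (x * y)) (x : U N) : p x := by
  let S : Subalgebra ℂ (U N) :=
    { carrier := {x | p x}
      mul_mem' := fun {a b} ha hb => hmul a b ha hb
      add_mem' := fun {a b} ha hb => hadd a b ha hb
      algebraMap_mem' := halg }
  let f : gl N →ₗ⁅ℂ⁆ S :=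
    { toFun := fun A => ⟨incl N A, hincl A⟩
      map_add' := fun A B => Subtype.ext (map_add _ A B)
      map_smul' := fun c A => Subtype.ext (map_smul _ c A)
      map_lie' := fun {A B} => Subtype.ext (LieHom.map_lie _ A B) }
  have h : S.val.comp (UniversalEnvelopingAlgebra.lift ℂ f) = AlgHom.id ℂ (U N) := by
    apply UniversalEnvelopingAlgebra.hom_ext
    ext A
    exact congrArg Subtype.val (UniversalEnvelopingAlgebra.lift_ι_apply ℂ f A)
  have := (UniversalEnvelopingAlgebra.lift ℂ f x).2
  have h2 : ((UniversalEnvelopingAlgebra.lift ℂ f x : S) : U N) = x := DFunLike.congr_fun h x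
  rwa [h2] at this

section

variable {N : ℕ}

theorem star_algebraMap (c : ℂ) : star (algebraMap ℂ (U N) c) = algebraMap ℂ (U N) (star c) :=
  starFun_algebraMap N c

theorem star_incl (A : gl N) : star (incl N A) = incl N (star A) := by
  change starFun N (incl N A) = _
  unfold starFun; rw [starHom_incl]; rfl

theorem Ad_incl (g : G N) (A : gl N) : Ad g (incl N A) = incl N (adGl g A) :=
  UniversalEnvelopingAlgebra.lift_ι_apply ℂ _ A

end

namespace URep

variable {N : ℕ} {ι κ : Type} [Fintype ι] [DecidableEq ι] [Fintype κ] [DecidableEq κ]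

theorem mul_act (V : URep N ι) (W : URep N κ) {S : Matrix κ ι ℂ}
    (h : ∀ A, S * V.drho A = W.drho A * S) (x : U N) : S * V.act x = W.act x * S := by
  induction x using U_induction with
  | halg c => simp [Algebra.algebraMap_eq_smul_one]
  | hincl A => rw [act_incl, act_incl, h]
  | hadd x y hx hy => rw [map_add, map_add, Matrix.mul_add, Matrix.add_mul, hx, hy]
  | hmul x y hx hy =>
    rw [map_mul, map_mul, ← Matrix.mul_assoc, hx, Matrix.mul_assoc, hy, Matrix.mul_assoc]

theorem act_star (V : URep N ι) (x : U N) : V.act (star x) = star (V.act x) := by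
  induction x using U_induction with
  | halg c =>
    rw [star_algebraMap, AlgHom.commutes, AlgHom.commutes, Algebra.algebraMap_eq_smul_one,
      Algebra.algebraMap_eq_smul_one, star_smul, star_one]
  | hincl A => rw [star_incl, act_incl, act_incl, V.drho_star]
  | hadd x y hx hy => rw [star_add, map_add, map_add, star_add, hx, hy]
  | hmul x y hx hy => rw [star_mul, map_mul, map_mul, star_mul, hx, hy]

theorem rho_mul_act (V : URep N ι) (g : G N) (x : U N) :
    (V.rho g : Matrix ι ι ℂ) * V.act x = V.act (Ad g x) * (V.rho g : Matrix ι ι ℂ) := by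
  induction x using U_induction with
  | halg c => simp [Algebra.algebraMap_eq_smul_one]
  | hincl A => rw [Ad_incl, act_incl, act_incl, rho_mul_drho]
  | hadd x y hx hy => simp only [map_add, Matrix.mul_add, Matrix.add_mul, hx, hy]
  | hmul x y hx hy =>
    rw [map_mul, map_mul, map_mul, ← Matrix.mul_assoc, hx, Matrix.mul_assoc, hy, Matrix.mul_assoc]

theorem trace_act_Ad (V : URep N ι) (g : G N) (x : U N) :
    Matrix.trace (V.act (Ad g x)) = Matrix.trace (V.act x) := by
  have h : V.act (Ad g x) = (V.rho g : Matrix ι ι ℂ) * V.act x * star (V.rho g : Matrix ι ι ℂ) := by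
    rw [rho_mul_act, Matrix.mul_assoc, Unitary.mul_star_self_of_mem (V.rho g).2, Matrix.mul_one]
  rw [h, Matrix.trace_mul_comm, ← Matrix.mul_assoc, Unitary.coe_star_mul_self, Matrix.one_mul]

end URep

end

section

open Matrix MeasureTheory

variable {N : ℕ}

/-! ### Orthogonality of characters -/

instance : IsProbabilityMeasure (haarG N) := ⟨Measure.haarMeasure_self (K₀ := ⊤)⟩

instance : (haarG N).IsMulLeftInvariant := by unfold haarG; infer_instance

theorem integrable_haarG {E : Type} [NormedAddCommGroup E] [NormedSpace ℝ E] {f : G N → E}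
    (hf : Continuous f) : Integrable f (haarG N) :=
  hf.integrable_of_hasCompactSupport (HasCompactSupport.of_compactSpace f)

theorem continuous_val_rho (V : Irrep N) :
    Continuous fun g : G N => (V.rho g : Matrix (Fin V.dim) (Fin V.dim) ℂ) :=
  continuous_subtype_val.comp V.continuous_rho

open scoped Matrix.Norms.L2Operator in
/-- The intertwiner `∫ ρ_W(g) E ρ_V(g)* dg` obtained by averaging a matrix `E`. -/
def average (V W : Irrep N) (E : Matrix (Fin W.dim) (Fin V.dim) ℂ) :
    Matrix (Fin W.dim) (Fin V.dim) ℂ :=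
  ∫ g : G N, (W.rho g : Matrix (Fin W.dim) (Fin W.dim) ℂ) * E *
    star (V.rho g : Matrix (Fin V.dim) (Fin V.dim) ℂ) ∂(haarG N)

open scoped Matrix.Norms.L2Operator in
theorem apply_average (V W : Irrep N) (E : Matrix (Fin W.dim) (Fin V.dim) ℂ)
    {F : Type} [NormedAddCommGroup F] [NormedSpace ℂ F] [CompleteSpace F]
    (f : Matrix (Fin W.dim) (Fin V.dim) ℂ →ₗ[ℂ] F) :
    f (average V W E) = ∫ g : G N, f ((W.rho g : Matrix (Fin W.dim) (Fin W.dim) ℂ) * E *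
      star (V.rho g : Matrix (Fin V.dim) (Fin V.dim) ℂ)) ∂(haarG N) := by
  have hV := continuous_val_rho V
  have hW := continuous_val_rho W
  exact (ContinuousLinearMap.integral_comp_comm (LinearMap.toContinuousLinearMap f)
    (integrable_haarG (by fun_prop))).symm

open scoped Matrix.Norms.L2Operator in
theorem average_mul_rho (V W : Irrep N) (E : Matrix (Fin W.dim) (Fin V.dim) ℂ) (h : G N) :
    average V W E * (V.rho h : Matrix (Fin V.dim) (Fin V.dim) ℂ)
      = (W.rho h : Matrix (Fin W.dim) (Fin W.dim) ℂ) * average V W E := by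
  let f : Matrix (Fin W.dim) (Fin V.dim) ℂ →ₗ[ℂ] Matrix (Fin W.dim) (Fin V.dim) ℂ :=
    { toFun := fun X => (W.rho h : Matrix (Fin W.dim) (Fin W.dim) ℂ) * X *
        star (V.rho h : Matrix (Fin V.dim) (Fin V.dim) ℂ)
      map_add' := fun X Y => by rw [Matrix.mul_add, Matrix.add_mul]
      map_smul' := fun c X => by simp }
  have h1 : f (average V W E) = average V W E := by
    rw [apply_average, average]
    rw [← integral_mul_left_eq_self (fun g : G N =>
      (W.rho g : Matrix (Fin W.dim) (Fin W.dim) ℂ) * E *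
        star (V.rho g : Matrix (Fin V.dim) (Fin V.dim) ℂ)) h]
    refine integral_congr_ae (Filter.Eventually.of_forall fun g => ?_)
    simp [f, star_mul, Matrix.mul_assoc]
  have h2 : (W.rho h : Matrix (Fin W.dim) (Fin W.dim) ℂ) * average V W E *
        star (V.rho h : Matrix (Fin V.dim) (Fin V.dim) ℂ) = average V W E := h1
  conv_lhs => rw [← h2]
  rw [Matrix.mul_assoc, Unitary.star_mul_self_of_mem (V.rho h).2, Matrix.mul_one]

/-- The inner product of two characters as a sum of matrix entries of averages. -/
theorem integral_trace_mul_star_trace (V W : Irrep N) :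
    ∫ g : G N, Matrix.trace (W.rho g : Matrix (Fin W.dim) (Fin W.dim) ℂ) *
        star (Matrix.trace (V.rho g : Matrix (Fin V.dim) (Fin V.dim) ℂ)) ∂(haarG N)
      = ∑ i, ∑ j, average V W (Matrix.single i j 1) i j := by
  have hV := continuous_val_rho V
  have hW := continuous_val_rho W
  have h1 : ∀ i j, average V W (Matrix.single i j 1) i j
      = ∫ g : G N, (W.rho g : Matrix (Fin W.dim) (Fin W.dim) ℂ) i i *
        star ((V.rho g : Matrix (Fin V.dim) (Fin V.dim) ℂ) j j) ∂(haarG N) := by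
    intro i j
    have := apply_average V W (Matrix.single i j 1) (Matrix.entryLinearMap ℂ ℂ i j)
    simp only [Matrix.entryLinearMap_apply] at this
    rw [this]
    refine integral_congr_ae (Filter.Eventually.of_forall fun g => ?_)
    simp [Matrix.mul_apply, Matrix.single_apply, Finset.sum_ite_eq, ite_and]
  simp only [h1]
  have hc : ∀ i j, Continuous fun g : G N => (W.rho g : Matrix (Fin W.dim) (Fin W.dim) ℂ) i i *
        star ((V.rho g : Matrix (Fin V.dim) (Fin V.dim) ℂ) j j) := fun i j =>
    (hW.matrix_elem i i).mul (hV.matrix_elem j j).star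
  have h2 : ∀ i, ∑ j, ∫ g : G N, (W.rho g : Matrix (Fin W.dim) (Fin W.dim) ℂ) i i *
        star ((V.rho g : Matrix (Fin V.dim) (Fin V.dim) ℂ) j j) ∂(haarG N)
      = ∫ g : G N, ∑ j, (W.rho g : Matrix (Fin W.dim) (Fin W.dim) ℂ) i i *
        star ((V.rho g : Matrix (Fin V.dim) (Fin V.dim) ℂ) j j) ∂(haarG N) := fun i =>
    (integral_finsetSum _ fun j _ => integrable_haarG (hc i j)).symm
  simp only [h2]
  rw [← integral_finsetSum _ fun i _ => integrable_haarG
    (continuous_finsetSum _ fun j _ => hc i j)]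
  refine integral_congr_ae (Filter.Eventually.of_forall fun g => ?_)
  simp only [Matrix.trace, Matrix.diag_apply, star_sum, Finset.sum_mul_sum]

open Classical in
/-- The irreducible characters are orthonormal in `L²(U(N))`. -/
theorem integral_character_mul_star (l l' : Dual N) :
    ∫ g : G N, character l g * star (character l' g) ∂(haarG N) = if l = l' then 1 else 0 := by
  unfold character
  rw [integral_trace_mul_star_trace]
  by_cases h : l = l'
  · subst h
    rw [if_pos rfl]
    have hd : ((rep l).dim : ℂ) ≠ 0 := by exact_mod_cast (rep l).dim_pos.ne'
    have h1 : ∀ i j, average (rep l) (rep l) (Matrix.single i j 1) i j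
        = if i = j then ((rep l).dim : ℂ)⁻¹ else 0 := by
      intro i j
      obtain ⟨c, hc⟩ := (rep l).exists_eq_smul_one _
        (average_mul_rho (rep l) (rep l) (Matrix.single i j 1))
      -- The trace of the average is the trace of the averaged matrix.
      have h2 := apply_average (rep l) (rep l) (Matrix.single i j 1)
        (Matrix.traceLinearMap (Fin (rep l).dim) ℂ ℂ)
      have h3 : ∀ g : G N, Matrix.trace (((rep l).rho g : Matrix _ _ ℂ) * Matrix.single i j 1 *
          star ((rep l).rho g : Matrix _ _ ℂ)) = if i = j then 1 else 0 := fun g => by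
        rw [Matrix.trace_mul_comm, ← Matrix.mul_assoc, Unitary.star_mul_self_of_mem
          ((rep l).rho g).2, Matrix.one_mul]
        by_cases hij : i = j
        · subst hij; simp
        · simp [hij, Matrix.trace_single_eq_of_ne _ _ _ hij]
      simp only [Matrix.traceLinearMap_apply, h3, integral_const, hc] at h2
      rw [hc]
      by_cases hij : i = j
      · subst hij
        simp at h2
        simp
        field_simp
        simpa using h2
      · simp [hij]
    simp only [h1]
    simp [hd]
  · rw [if_neg h]
    refine Finset.sum_eq_zero fun i _ => Finset.sum_eq_zero fun j _ => ?_
    rw [Irrep.eq_zero_of_not_equiv (V := rep l') (W := rep l) (fun hE => h ?_) _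
      (average_mul_rho _ _ _)]
    · rfl
    · have := Quotient.sound (s := instSetoidIrrep N) hE
      rw [Quotient.out_eq, Quotient.out_eq] at this
      exact this.symm

end

section

open Matrix MeasureTheory

variable {N : ℕ}

/-! ### The Fourier coefficients of `κ_t` -/

/-- The trace of an operator which acts on the constituents by `Y a` is the sum of the traces of
the `Y a`. -/
theorem URep.Decomp.trace_eq {ι : Type} [Fintype ι] [DecidableEq ι] {V : URep N ι} (D : V.Decomp)
    {X : Matrix ι ι ℂ} {Y : ∀ a, Matrix (Fin (rep (D.cls a)).dim) (Fin (rep (D.cls a)).dim) ℂ}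
    (h : ∀ a, X * D.iso a = D.iso a * Y a) : Matrix.trace X = ∑ a, Matrix.trace (Y a) := by
  calc Matrix.trace X = Matrix.trace (X * ∑ a, D.iso a * (D.iso a)ᴴ) := by
        rw [D.sum_eq_one, Matrix.mul_one]
    _ = ∑ a, Matrix.trace (X * D.iso a * (D.iso a)ᴴ) := by
        simp only [Matrix.mul_sum, Matrix.trace_sum, Matrix.mul_assoc]
    _ = _ := Finset.sum_congr rfl fun a _ => by
        rw [h, Matrix.trace_mul_comm, ← Matrix.mul_assoc, D.isometry, Matrix.one_mul]

theorem URep.Decomp.drho_mul {ι : Type} [Fintype ι] [DecidableEq ι] {V : URep N ι} (D : V.Decomp)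
    (a : D.index) (A : gl N) :
    V.drho A * D.iso a = D.iso a * (rep (D.cls a)).drho A :=
  (URep.mul_drho (rep (D.cls a)).toURep V (fun g => (D.rho_mul a g).symm) A).symm

theorem URep.Decomp.act_mul {ι : Type} [Fintype ι] [DecidableEq ι] {V : URep N ι} (D : V.Decomp)
    (a : D.index) (x : U N) :
    V.act x * D.iso a = D.iso a * (rep (D.cls a)).toURep.act x :=
  (URep.mul_act (rep (D.cls a)).toURep V (fun A => (D.drho_mul a A).symm) x).symm

variable (N) in
/-- A chosen decomposition of the `k`-th tensor power of the standard representation. -/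
def decomp (k : ℕ) : (URep.tensorPow N k).Decomp := Classical.choice (URep.nonempty_decomp _)

variable (N) in
/-- The irreducible constituents of all tensor powers, counted with multiplicity. -/
abbrev Piece : Type := Σ k : ℕ, (decomp N k).index

/-- The class of an irreducible constituent. -/
def Piece.cls (p : Piece N) : Dual N := (decomp N p.1).cls p.2

/-- The dimension of an irreducible constituent. -/
abbrev Piece.dim (p : Piece N) : ℕ := (rep p.cls).dim

theorem trace_pow_eq (k : ℕ) (g : G N) :
    Matrix.trace (g : gl N) ^ k = ∑ a, character ((decomp N k).cls a) g := by
  rw [← URep.trace_rho_tensorPow]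
  exact (decomp N k).trace_eq fun a => (decomp N k).rho_mul a g

/-- Evaluation of `trace_pow_eq` at the identity. -/
theorem sum_dim_eq (k : ℕ) : ∑ a, ((rep ((decomp N k).cls a)).dim : ℝ) = (N : ℝ) ^ k := by
  have := trace_pow_eq k (1 : G N)
  simp only [character, map_one, OneMemClass.coe_one, Matrix.trace_one, Fintype.card_fin] at this
  exact_mod_cast this.symm

/-- The coefficients of the expansion of `κ_t` in powers of the trace. -/
def weight (N : ℕ) (t : ℝ) (k : ℕ) : ℝ := Real.exp (-(t * N)) * (t ^ k / k.factorial)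

theorem weight_nonneg {t : ℝ} (ht : 0 ≤ t) (k : ℕ) : 0 ≤ weight N t k := by
  unfold weight; positivity

theorem hasSum_kappaFun (t : ℝ) (g : G N) :
    HasSum (fun k => (weight N t k : ℂ) * Matrix.trace (g : gl N) ^ k) (kappaFun t g) := by
  have h := (NormedSpace.expSeries_div_hasSum_exp ((t : ℂ) * Matrix.trace (g : gl N))).mul_left
    (Complex.exp (-(t * N)))
  rw [← Complex.exp_eq_exp_ℂ, ← Complex.exp_add] at h
  have h1 : kappaFun t g = Complex.exp (-(t * N) + t * Matrix.trace (g : gl N)) := by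
    unfold kappaFun
    rw [Matrix.trace_sub, Matrix.trace_one, Fintype.card_fin]
    congr 1; ring
  rw [h1]
  refine h.congr_fun fun k => ?_
  simp only [weight]
  push_cast
  rw [mul_pow]; ring

theorem norm_trace_unitary_le {ι : Type} [Fintype ι] [DecidableEq ι]
    (u : Matrix.unitaryGroup ι ℂ) :
    ‖Matrix.trace (u : Matrix ι ι ℂ)‖ ≤ Fintype.card ι := by
  calc ‖∑ i, (u : Matrix ι ι ℂ) i i‖ ≤ ∑ i : ι, (1 : ℝ) :=
        norm_sum_le_of_le _ fun i _ => entry_norm_bound_of_unitary u.2 i i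
    _ = _ := by simp

/-- Exponential weights beat every polynomial. -/
theorem summable_weight_mul (t : ℝ) (ht : 0 ≤ t) (d : ℕ) :
    Summable fun k : ℕ => weight N t k * (N : ℝ) ^ k * (1 + k : ℝ) ^ d := by
  have h1 := (Real.summable_pow_div_factorial (t * N * Real.exp 1)).mul_left
    (Real.exp (-(t * N)) * (d.factorial * Real.exp 1))
  refine Summable.of_nonneg_of_le (fun k => ?_) (fun k => ?_) h1
  · have := weight_nonneg (N := N) ht k
    positivity
  · have h2 : (1 + k : ℝ) ^ d ≤ d.factorial * (Real.exp 1 * Real.exp 1 ^ k) := by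
      have h3 := Real.pow_div_factorial_le_exp (1 + k : ℝ) (by positivity) d
      rw [div_le_iff₀ (by positivity)] at h3
      rw [← Real.exp_nat_mul, mul_one, ← Real.exp_add]
      linarith
    calc weight N t k * (N : ℝ) ^ k * (1 + k : ℝ) ^ d
        ≤ weight N t k * (N : ℝ) ^ k * (d.factorial * (Real.exp 1 * Real.exp 1 ^ k)) := by
          have := weight_nonneg (N := N) ht k
          gcongr
      _ = _ := by unfold weight; rw [mul_pow, mul_pow]; ring

open Classical in
/-- The coefficient of `κ_t` at `l`, divided by the dimension, is the weighted sum of the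
multiplicities of `l` in the tensor powers: integrate `hasSum_kappaFun` against the character. -/
theorem hasSum_kappaHat (t : ℝ) (ht : 0 ≤ t) (l : Dual N) :
    HasSum (fun k => ∑ a, if (decomp N k).cls a = l then (weight N t k : ℂ) else 0)
      (kappaHat t l / (rep l).dim) := by
  have hd : ((rep l).dim : ℂ) ≠ 0 := by exact_mod_cast (rep l).dim_pos.ne'
  have hχ : ∀ l : Dual N, Continuous fun g : G N => character l g := fun l =>
    (continuous_val_rho (rep l)).matrix_trace
  have htr : Continuous fun g : G N => Matrix.trace (g : gl N) :=
    continuous_subtype_val.matrix_trace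
  rw [kappaHat, mul_div_cancel_left₀ _ hd]
  have hcont : ∀ k : ℕ, Continuous fun g : G N =>
      (weight N t k : ℂ) * Matrix.trace (g : gl N) ^ k * star (character l g) := fun k =>
    (continuous_const.mul (htr.pow k)).mul (hχ l).star
  have h1 : HasSum (fun k => ∫ g : G N, (weight N t k : ℂ) * Matrix.trace (g : gl N) ^ k *
      star (character l g) ∂(haarG N)) (∫ g : G N, ∑' k, (weight N t k : ℂ) *
        Matrix.trace (g : gl N) ^ k * star (character l g) ∂(haarG N)) := by
    refine hasSum_integral_of_summable_integral_norm (fun k => integrable_haarG (hcont k)) ?_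
    have h2 := ((summable_weight_mul (N := N) t ht 0).mul_right ((rep l).dim : ℝ))
    refine Summable.of_nonneg_of_le (fun k => integral_nonneg fun g => norm_nonneg _)
      (fun k => ?_) h2
    calc ∫ g : G N, ‖(weight N t k : ℂ) * Matrix.trace (g : gl N) ^ k *
          star (character l g)‖ ∂(haarG N)
        ≤ ∫ _ : G N, weight N t k * (N : ℝ) ^ k * (1 + k : ℝ) ^ 0 * ((rep l).dim : ℝ)
            ∂(haarG N) := by
          refine integral_mono (integrable_haarG (hcont k)).norm (integrable_const _) fun g => ?_
          have h3 := norm_trace_unitary_le g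
          have h4 : ‖character l g‖ ≤ _ := norm_trace_unitary_le ((rep l).rho g)
          have h5 := weight_nonneg (N := N) ht k
          simp only [Fintype.card_fin] at h3 h4
          simp only [norm_mul, norm_pow, norm_star, Complex.norm_real, Real.norm_eq_abs,
            abs_of_nonneg h5, pow_zero, mul_one]
          gcongr
      _ = _ := by simp
  have h6 : ∀ g : G N, ∑' k, (weight N t k : ℂ) * Matrix.trace (g : gl N) ^ k *
      star (character l g) = kappaFun t g * star (character l g) := fun g =>
    ((hasSum_kappaFun t g).mul_right _).tsum_eq
  simp only [h6] at h1
  convert h1 using 2 with k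
  have h7 : ∀ g : G N, (weight N t k : ℂ) * Matrix.trace (g : gl N) ^ k * star (character l g)
      = ∑ a, (weight N t k : ℂ) * (character ((decomp N k).cls a) g * star (character l g)) := by
    intro g
    rw [trace_pow_eq, Finset.mul_sum, Finset.sum_mul]
    exact Finset.sum_congr rfl fun a _ => by ring
  simp only [h7]
  have h8 : ∀ a ∈ Finset.univ, Integrable (fun g : G N => (weight N t k : ℂ) *
      (character ((decomp N k).cls a) g * star (character l g))) (haarG N) := fun a _ =>
    integrable_haarG (continuous_const.mul ((hχ _).mul (hχ l).star))
  rw [integral_finsetSum _ h8]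
  refine Finset.sum_congr rfl fun a _ => ?_
  rw [integral_const_mul, integral_character_mul_star]
  split_ifs <;> simp

theorem summable_piece (t : ℝ) (ht : 0 ≤ t) (C : ℝ) (d : ℕ) :
    Summable fun p : Piece N => weight N t p.1 * p.dim * (C * (1 + p.1 : ℝ) ^ d) := by
  have h1 : Summable fun p : Piece N => weight N t p.1 * p.dim * (1 + p.1 : ℝ) ^ d := by
    rw [summable_sigma_of_nonneg fun p => by
      have := weight_nonneg (N := N) ht p.1
      positivity]
    refine ⟨fun k => (hasSum_fintype _).summable, ?_⟩
    convert summable_weight_mul (N := N) t ht d using 2 with k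
    rw [tsum_fintype, ← sum_dim_eq, Finset.mul_sum, Finset.sum_mul]
    rfl
  exact (h1.mul_left C).congr fun p => by ring

/-- The Fourier coefficient counts, with weights, the constituents of a given class. -/
theorem tsum_weight_fiber (t : ℝ) (ht : 0 ≤ t) (l : Dual N) :
    ∑' p : Piece.cls (N := N) ⁻¹' {l}, (weight N t p.1.1 : ℂ) = kappaHat t l / (rep l).dim := by
  classical
  rw [← (hasSum_kappaHat t ht l).tsum_eq,
    tsum_subtype (Piece.cls (N := N) ⁻¹' {l}) fun p : Piece N => (weight N t p.1 : ℂ)]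
  have h1 : Summable fun p : Piece N => (weight N t p.1 : ℂ) := by
    refine Summable.of_norm_bounded (summable_piece t ht 1 0) fun p => ?_
    have h2 := weight_nonneg (N := N) ht p.1
    have h3 : (1 : ℝ) ≤ p.dim := by exact_mod_cast (rep p.cls).dim_pos
    rw [Complex.norm_real, Real.norm_eq_abs, abs_of_nonneg h2]
    simp only [pow_zero, mul_one]
    nlinarith
  rw [(h1.indicator _).tsum_sigma' fun k => (hasSum_fintype _).summable]
  refine tsum_congr fun k => ?_
  rw [tsum_fintype]
  exact Finset.sum_congr rfl fun a _ => by simp [Set.indicator_apply, Piece.cls]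

/-! ### Growth of the operators in `M` and convergence of `κ_t` -/

open scoped Matrix.Norms.L2Operator in
/-- Polynomial growth: the blocks of `T` on constituents of the `k`-th tensor power are bounded by
a polynomial in `k`. -/
def PolyGrowth (T : BlockOp N) : Prop :=
  ∃ (C : ℝ) (d : ℕ), 0 ≤ C ∧ ∀ (p : Piece N) (i : Fin p.dim),
    ‖T ⟨p.cls, i⟩‖ ≤ C * (1 + p.1 : ℝ) ^ d

open scoped Matrix.Norms.L2Operator

theorem norm_algebraMap_le {ι : Type} [Fintype ι] [DecidableEq ι] (c : ℂ) :
    ‖algebraMap ℂ (Matrix ι ι ℂ) c‖ ≤ ‖c‖ := by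
  rw [Algebra.algebraMap_eq_smul_one, norm_smul]
  have : ‖(1 : Matrix ι ι ℂ)‖ ≤ 1 := norm_le_one_of_isometry (by simp)
  exact mul_le_of_le_one_right (norm_nonneg c) this

theorem polyGrowth_algebraMap (c : ℂ) : PolyGrowth (algebraMap ℂ (BlockOp N) c) :=
  ⟨‖c‖, 0, norm_nonneg c, fun p i => by simpa using norm_algebraMap_le c⟩

theorem PolyGrowth.add {S T : BlockOp N} (hS : PolyGrowth S) (hT : PolyGrowth T) :
    PolyGrowth (S + T) := by
  obtain ⟨C, d, hC, h⟩ := hS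
  obtain ⟨C', d', hC', h'⟩ := hT
  refine ⟨C + C', d + d', by positivity, fun p i => ?_⟩
  have h1 : (1 : ℝ) ≤ 1 + p.1 := by simp
  calc ‖S ⟨p.cls, i⟩ + T ⟨p.cls, i⟩‖ ≤ C * (1 + p.1 : ℝ) ^ d + C' * (1 + p.1 : ℝ) ^ d' :=
        (norm_add_le _ _).trans (add_le_add (h p i) (h' p i))
    _ ≤ C * (1 + p.1 : ℝ) ^ (d + d') + C' * (1 + p.1 : ℝ) ^ (d + d') := by
        gcongr <;> first | exact h1 | omega
    _ = _ := by ring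

theorem PolyGrowth.mul {S T : BlockOp N} (hS : PolyGrowth S) (hT : PolyGrowth T) :
    PolyGrowth (S * T) := by
  obtain ⟨C, d, hC, h⟩ := hS
  obtain ⟨C', d', hC', h'⟩ := hT
  refine ⟨C * C', d + d', by positivity, fun p i => ?_⟩
  calc ‖S ⟨p.cls, i⟩ * T ⟨p.cls, i⟩‖ ≤ (C * (1 + p.1 : ℝ) ^ d) * (C' * (1 + p.1 : ℝ) ^ d') :=
        (norm_mul_le _ _).trans (mul_le_mul (h p i) (h' p i) (norm_nonneg _) (by positivity))
    _ = _ := by ring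

theorem PolyGrowth.star {T : BlockOp N} (hT : PolyGrowth T) : PolyGrowth (star T) := by
  obtain ⟨C, d, hC, h⟩ := hT
  exact ⟨C, d, hC, fun p i => (norm_star (T ⟨p.cls, i⟩)).trans_le (h p i)⟩

/-- The operators `π(A)`, `A ∈ gl_N`, have linear growth, since `A` acts on a tensor power by a sum
of `k` operators of norm at most `‖A‖`. -/
theorem polyGrowth_piBlock (x : U N) : PolyGrowth (piBlock N x) := by
  induction x using U_induction with
  | halg c => rw [AlgHom.commutes]; exact polyGrowth_algebraMap c
  | hincl A =>
    refine ⟨‖A‖, 1, norm_nonneg A, fun p i => ?_⟩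
    have h1 : piBlock N (incl N A) ⟨p.cls, i⟩ = (rep p.cls).drho A :=
      UniversalEnvelopingAlgebra.lift_ι_apply ℂ _ A
    have h2 : (rep p.cls).drho A = ((decomp N p.1).iso p.2)ᴴ *
        (URep.tensorPow N p.1).drho A * (decomp N p.1).iso p.2 := by
      rw [Matrix.mul_assoc, (decomp N p.1).drho_mul, ← Matrix.mul_assoc,
        (decomp N p.1).isometry, Matrix.one_mul]
      rfl
    rw [h1, h2]
    calc _ ≤ ‖(URep.tensorPow N p.1).drho A‖ := norm_conj_isometry_le ((decomp N p.1).isometry _) _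
      _ ≤ p.1 * ‖A‖ := URep.norm_drho_tensorPow_le _ _
      _ ≤ _ := by nlinarith [norm_nonneg A]
  | hadd x y hx hy => rw [map_add]; exact hx.add hy
  | hmul x y hx hy => rw [map_mul]; exact hx.mul hy

/-- Polynomial growth holds for bounded operators and for `π(X)`, and passes to the generated
`*`-algebra. -/
theorem polyGrowth_M (T : M N) : PolyGrowth (T : BlockOp N) := by
  obtain ⟨T, hT⟩ := T
  change PolyGrowth T
  induction hT using StarAlgebra.adjoin_induction with
  | mem x hx =>
    rcases hx with ⟨C, hC⟩ | ⟨X, rfl⟩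
    · refine ⟨max C 0, 0, le_max_right _ _, fun p i => ?_⟩
      simpa using Or.inl (hC ⟨p.cls, i⟩)
    · exact polyGrowth_piBlock X
  | algebraMap r => exact polyGrowth_algebraMap r
  | add x y _ _ hx hy => exact hx.add hy
  | mul x y _ _ hx hy => exact hx.mul hy
  | star x _ hx => exact hx.star

/-- The average over the copies of `V_l` of the trace of `T`. -/
def meanTrace (T : M N) (l : Dual N) : ℂ :=
  (∑ i : Fin (rep l).dim, Matrix.trace ((T : BlockOp N) ⟨l, i⟩)) / (rep l).dim

theorem summable_meanTrace (t : ℝ) (ht : 0 ≤ t) (T : M N) :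
    Summable fun p : Piece N => (weight N t p.1 : ℂ) * meanTrace T p.cls := by
  obtain ⟨C, d, hC, h⟩ := polyGrowth_M T
  refine Summable.of_norm_bounded (summable_piece t ht C d) fun p => ?_
  have hw := weight_nonneg (N := N) ht p.1
  have hd : (0 : ℝ) < p.dim := by exact_mod_cast (rep p.cls).dim_pos
  rw [norm_mul, Complex.norm_real, Real.norm_eq_abs, abs_of_nonneg hw, mul_assoc, meanTrace,
    norm_div, Complex.norm_natCast]
  gcongr
  rw [div_le_iff₀ hd]
  calc ‖∑ i : Fin p.dim, Matrix.trace ((T : BlockOp N) ⟨p.cls, i⟩)‖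
      ≤ ∑ _i : Fin p.dim, (p.dim * (C * (1 + p.1 : ℝ) ^ d)) :=
        norm_sum_le_of_le _ fun i _ => (norm_trace_le _).trans (by
          rw [Fintype.card_fin]
          gcongr
          exact h p i)
    _ = _ := by simp; ring

/-- The series over the unitary dual arises by grouping the absolutely convergent series over all
constituents of the tensor powers according to their classes. -/
theorem hasSum_stateTerm_meanTrace (t : ℝ) (ht : 0 ≤ t) (T : M N) :
    HasSum (stateTerm t T) (∑' p : Piece N, (weight N t p.1 : ℂ) * meanTrace T p.cls) := by
  have h := (summable_meanTrace t ht T).hasSum.tsum_fiberwise (Piece.cls (N := N))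
  refine h.congr_fun fun l => ?_
  have h1 : ∀ p : Piece.cls (N := N) ⁻¹' {l}, (weight N t p.1.1 : ℂ) * meanTrace T p.1.cls
      = (weight N t p.1.1 : ℂ) * meanTrace T l := fun p => by
    have : p.1.cls = l := p.2
    rw [this]
  simp only [h1]
  rw [tsum_mul_right, tsum_weight_fiber t ht, stateTerm, meanTrace]
  have hd : ((rep l).dim : ℂ) ≠ 0 := by exact_mod_cast (rep l).dim_pos.ne'
  field_simp

theorem kappa_apply (t : ℝ) (ht : 0 ≤ t) (T : M N) : kappa t T = ∑' l, stateTerm t T l := by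
  have h : ∀ T : M N, Summable (stateTerm t T) :=
    fun T => (hasSum_stateTerm_meanTrace t ht T).summable
  unfold kappa
  rw [dif_pos h]
  rfl

theorem hasSum_kappa (t : ℝ) (ht : 0 ≤ t) (T : M N) : HasSum (stateTerm t T) (kappa t T) := by
  rw [kappa_apply t ht]
  exact (hasSum_stateTerm_meanTrace t ht T).summable.hasSum

theorem hasSum_kappa_piece (t : ℝ) (ht : 0 ≤ t) (T : M N) :
    HasSum (fun p : Piece N => (weight N t p.1 : ℂ) * meanTrace T p.cls) (kappa t T) := by
  rw [(hasSum_kappa t ht T).unique (hasSum_stateTerm_meanTrace t ht T)]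
  exact (summable_meanTrace t ht T).hasSum

theorem meanTrace_piM (X : U N) (l : Dual N) :
    meanTrace (piM N X) l = Matrix.trace ((rep l).toURep.act X) := by
  have hd : ((rep l).dim : ℂ) ≠ 0 := by exact_mod_cast (rep l).dim_pos.ne'
  have h : meanTrace (piM N X) l = (∑ _i : Fin (rep l).dim,
      Matrix.trace ((rep l).toURep.act X)) / (rep l).dim := rfl
  rw [h, Finset.sum_const, Finset.card_univ, Fintype.card_fin, nsmul_eq_mul, mul_div_cancel_left₀ _ hd]

/-- `⟨X⟩_t` is the Poisson average of the traces of `X` in the tensor powers of the standard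
representation. -/
theorem hasSum_bracket (t : ℝ) (ht : 0 ≤ t) (X : U N) :
    HasSum (fun k => (weight N t k : ℂ) * Matrix.trace ((URep.tensorPow N k).act X))
      (bracket t X) := by
  have h := (hasSum_kappa_piece t ht (piM N X)).sigma fun k => hasSum_fintype _
  refine h.congr_fun fun k => ?_
  rw [(decomp N k).trace_eq fun a => (decomp N k).act_mul a X, Finset.mul_sum]
  refine Finset.sum_congr rfl fun a _ => ?_
  congr 1
  exact (meanTrace_piM X _).symm

/-! ### The states `κ_t` and `⟨·⟩_t` -/

/-- `κ_t(1)` is the value of the function `κ_t` at the identity of the group. -/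
theorem kappa_one (t : ℝ) (ht : 0 ≤ t) : kappa t (1 : M N) = 1 := by
  have h := hasSum_bracket t ht (1 : U N)
  have h1 := hasSum_kappaFun t (1 : G N)
  simp only [map_one, Matrix.trace_one, OneMemClass.coe_one] at h h1
  have h2 : kappaFun t (1 : G N) = 1 := by simp [kappaFun]
  have h3 : bracket t (1 : U N) = kappa t (1 : M N) := by
    change kappa t (piM N 1) = _
    rw [map_one]
  rw [← h3, ← h2]
  refine h.unique ?_
  convert h1 using 3 with k
  simp

open scoped ComplexOrder in
theorem kappa_star_mul_self_nonneg (t : ℝ) (ht : 0 ≤ t) (T : M N) : 0 ≤ kappa t (star T * T) := by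
  refine (hasSum_kappa_piece t ht _).nonneg fun p => ?_
  refine mul_nonneg (by exact_mod_cast weight_nonneg ht p.1) ?_
  refine div_nonneg (Finset.sum_nonneg fun i _ => ?_) (by positivity)
  exact (Matrix.posSemidef_conjTranspose_mul_self ((T : BlockOp N) ⟨p.cls, i⟩)).trace_nonneg

theorem isState_kappa (t : ℝ) (ht : 0 ≤ t) : IsState (kappa (N := N) t) where
  map_one := kappa_one t ht
  im_eq_zero T := (Complex.nonneg_iff.1 (kappa_star_mul_self_nonneg t ht T)).2.symm
  re_nonneg T := (Complex.nonneg_iff.1 (kappa_star_mul_self_nonneg t ht T)).1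

theorem piM_star (X : U N) : piM N (star X) = star (piM N X) :=
  Subtype.ext (funext fun s => (rep s.1).toURep.act_star X)

theorem isState_bracket (t : ℝ) (ht : 0 ≤ t) : IsState (bracket (N := N) t) where
  map_one := by
    change kappa t (piM N 1) = 1
    rw [map_one, kappa_one t ht]
  im_eq_zero X := by
    change (kappa t (piM N (star X * X))).im = 0
    rw [map_mul, piM_star]
    exact (isState_kappa t ht).im_eq_zero _
  re_nonneg X := by
    change 0 ≤ (kappa t (piM N (star X * X))).re
    rw [map_mul, piM_star]
    exact (isState_kappa t ht).re_nonneg _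

end

section

open Matrix

/-! ### States on `*`-algebras and Gram matrices -/

section State

variable {A : Type} [Ring A] [StarRing A] [Algebra ℂ A] {φ : A →ₗ[ℂ] ℂ}

open scoped ComplexOrder in
theorem IsState.nonneg (hφ : IsState φ) (a : A) : 0 ≤ φ (star a * a) :=
  Complex.nonneg_iff.2 ⟨hφ.re_nonneg a, (hφ.im_eq_zero a).symm⟩

variable [StarModule ℂ A]

/-- States are Hermitian, by polarization. -/
theorem IsState.map_star (hφ : IsState φ) (a : A) : φ (star a) = star (φ a) := by
  have h1 := hφ.im_eq_zero (1 + a)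
  have h2 := hφ.im_eq_zero (1 + Complex.I • a)
  have h3 := hφ.im_eq_zero a
  simp only [star_add, star_one, star_smul, add_mul, mul_add, one_mul, mul_one, map_add,
    smul_mul_assoc, mul_smul_comm, map_smul, hφ.map_one, smul_eq_mul] at h1 h2
  apply Complex.ext
  · simp at h1 h2 h3 ⊢
    linarith
  · simp at h1 h2 h3 ⊢
    linarith

open scoped ComplexOrder in
theorem IsState.gram_posSemidef (hφ : IsState φ) {α : Type} [Fintype α] (y : α → A) :
    (Matrix.of fun a b => φ (star (y a) * y b)).PosSemidef := by
  refine Matrix.PosSemidef.of_dotProduct_mulVec_nonneg ?_ fun v => ?_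
  · ext a b
    simp [← starRingEnd_apply, Matrix.conjTranspose_apply]
    rw [starRingEnd_apply, ← hφ.map_star, star_mul, star_star]
  · convert hφ.nonneg (∑ a, v a • y a)
    rw [star_sum, Finset.sum_mul_sum]
    simp only [dotProduct, Matrix.mulVec, Matrix.of_apply, star_smul, map_sum, smul_mul_smul_comm,
      map_smul, Finset.mul_sum, smul_eq_mul, Pi.star_apply]
    exact Finset.sum_congr rfl fun a _ => Finset.sum_congr rfl fun b _ => by ring

end State

/-! ### Convolution operators on the enveloping algebra -/

variable {N : ℕ}

instance : StarModule ℂ (U N) where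
  star_smul c x := by
    rw [Algebra.smul_def, star_mul, star_algebraMap, Algebra.smul_def, Algebra.commutes]

theorem coproduct_incl (A : gl N) :
    coproduct N (incl N A) = incl N A ⊗ₜ[ℂ] 1 + 1 ⊗ₜ[ℂ] incl N A :=
  UniversalEnvelopingAlgebra.lift_ι_apply ℂ _ A

section Slice

variable {E F : Type} [AddCommGroup E] [Module ℂ E] [AddCommGroup F] [Module ℂ F]

/-- The slice map `id ⊗ φ`. -/
def slice (φ : F →ₗ[ℂ] ℂ) : E ⊗[ℂ] F →ₗ[ℂ] E :=
  (TensorProduct.rid ℂ E).toLinearMap ∘ₗ φ.lTensor E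

@[simp]
theorem slice_tmul (φ : F →ₗ[ℂ] ℂ) (x : E) (y : F) : slice φ (x ⊗ₜ[ℂ] y) = φ y • x := by
  simp [slice]

end Slice

/-- Convolution `(id ⊗ φ) ∘ Δ` by a functional. -/
def convOp (φ : U N →ₗ[ℂ] ℂ) : U N →ₗ[ℂ] U N := slice φ ∘ₗ (coproduct N).toLinearMap

theorem convOp_apply (φ : U N →ₗ[ℂ] ℂ) (x : U N) : convOp φ x = slice φ (coproduct N x) := rfl

theorem P_eq_convOp (t : ℝ) : P (N := N) t = convOp (bracket t) := rfl

variable (N) in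
theorem coproduct_coassoc :
    (Algebra.TensorProduct.assoc ℂ ℂ ℂ (U N) (U N) (U N)).toAlgHom.comp
        ((Algebra.TensorProduct.map (coproduct N) (AlgHom.id ℂ (U N))).comp (coproduct N))
      = (Algebra.TensorProduct.map (AlgHom.id ℂ (U N)) (coproduct N)).comp (coproduct N) := by
  apply UniversalEnvelopingAlgebra.hom_ext
  ext A
  change (Algebra.TensorProduct.assoc ℂ ℂ ℂ (U N) (U N) (U N))
      (Algebra.TensorProduct.map (coproduct N) (AlgHom.id ℂ (U N)) (coproduct N (incl N A)))
    = Algebra.TensorProduct.map (AlgHom.id ℂ (U N)) (coproduct N) (coproduct N (incl N A))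
  simp [-UniversalEnvelopingAlgebra.ι_apply, coproduct_incl, TensorProduct.add_tmul, TensorProduct.tmul_add, add_assoc,
    Algebra.TensorProduct.one_def]

/-- Coassociativity: `convOp` turns the convolution `(φ ⊗ ψ) ∘ Δ = φ ∘ convOp ψ` of functionals into
the composition of operators. -/
theorem convOp_comp (φ ψ : U N →ₗ[ℂ] ℂ) :
    convOp φ ∘ₗ convOp ψ = convOp (φ ∘ₗ convOp ψ) := by
  have h1 : ∀ z : U N ⊗[ℂ] U N, convOp φ (slice ψ z) = slice φ (slice ψ
      (Algebra.TensorProduct.map (coproduct N) (AlgHom.id ℂ (U N)) z)) := by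
    intro z
    induction z with
    | zero => simp
    | tmul x y => simp [convOp_apply]
    | add x y hx hy => simp only [map_add, hx, hy]
  have h2 : ∀ z : (U N ⊗[ℂ] U N) ⊗[ℂ] U N, slice φ (slice ψ z) = slice (φ ∘ₗ slice ψ)
      (Algebra.TensorProduct.assoc ℂ ℂ ℂ (U N) (U N) (U N) z) := by
    intro z
    induction z with
    | zero => simp
    | tmul z w =>
      induction z with
      | zero => simp
      | tmul x y => simp [smul_smul]
      | add x y hx hy => simp only [map_add, hx, hy, TensorProduct.add_tmul]
    | add x y hx hy => simp only [map_add, hx, hy]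
  have h3 : ∀ z : U N ⊗[ℂ] U N, slice (φ ∘ₗ slice ψ)
      (Algebra.TensorProduct.map (AlgHom.id ℂ (U N)) (coproduct N) z)
      = slice (φ ∘ₗ convOp ψ) z := by
    intro z
    induction z with
    | zero => simp
    | tmul x y => simp [convOp_apply]
    | add x y hx hy => simp only [map_add, hx, hy]
  ext1 x
  rw [LinearMap.comp_apply, convOp_apply ψ, h1, h2, convOp_apply, ← h3]
  exact congrArg _ (DFunLike.congr_fun (coproduct_coassoc N) x)

variable (N) in
/-- The counit of the enveloping algebra. -/
def counit : U N →ₐ[ℂ] ℂ := UniversalEnvelopingAlgebra.lift ℂ 0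

theorem counit_incl (A : gl N) : counit N (incl N A) = 0 :=
  UniversalEnvelopingAlgebra.lift_ι_apply ℂ _ A

theorem convOp_counit : convOp (counit N).toLinearMap = LinearMap.id := by
  have h : ((Algebra.TensorProduct.rid ℂ ℂ (U N)).toAlgHom.comp
      (Algebra.TensorProduct.map (AlgHom.id ℂ (U N)) (counit N))).comp (coproduct N)
      = AlgHom.id ℂ (U N) := by
    apply UniversalEnvelopingAlgebra.hom_ext
    ext A
    change (Algebra.TensorProduct.rid ℂ ℂ (U N)) (Algebra.TensorProduct.map (AlgHom.id ℂ (U N))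
      (counit N) (coproduct N (incl N A))) = incl N A
    simp [-UniversalEnvelopingAlgebra.ι_apply, coproduct_incl, counit_incl]
  exact LinearMap.ext fun x => DFunLike.congr_fun h x

theorem counit_convOp (φ : U N →ₗ[ℂ] ℂ) : (counit N).toLinearMap ∘ₗ convOp φ = φ := by
  have h : ((Algebra.TensorProduct.lid ℂ (U N)).toAlgHom.comp
      (Algebra.TensorProduct.map (counit N) (AlgHom.id ℂ (U N)))).comp (coproduct N)
      = AlgHom.id ℂ (U N) := by
    apply UniversalEnvelopingAlgebra.hom_ext
    ext A
    change (Algebra.TensorProduct.lid ℂ (U N)) (Algebra.TensorProduct.map (counit N)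
      (AlgHom.id ℂ (U N)) (coproduct N (incl N A))) = incl N A
    simp [-UniversalEnvelopingAlgebra.ι_apply, coproduct_incl, counit_incl]
  have h2 : ∀ z : U N ⊗[ℂ] U N, counit N (slice φ z) = φ (Algebra.TensorProduct.lid ℂ (U N)
      (Algebra.TensorProduct.map (counit N) (AlgHom.id ℂ (U N)) z)) := by
    intro z
    induction z with
    | zero => simp
    | tmul x y => simp [mul_comm]
    | add x y hx hy => simp only [map_add, hx, hy]
  exact LinearMap.ext fun x => (h2 _).trans (congrArg φ (DFunLike.congr_fun h x))

/-! ### Invariance -/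

/-- Convolution by an `Ad(g)`-invariant functional commutes with `Ad(g)`. -/
theorem convOp_Ad {φ : U N →ₗ[ℂ] ℂ} {g : G N} (hφ : ∀ x, φ (Ad g x) = φ x) (x : U N) :
    convOp φ (Ad g x) = Ad g (convOp φ x) := by
  have h1 : (coproduct N).comp (Ad g)
      = (Algebra.TensorProduct.map (Ad g) (Ad g)).comp (coproduct N) := by
    apply UniversalEnvelopingAlgebra.hom_ext
    ext A
    change coproduct N (Ad g (incl N A))
      = Algebra.TensorProduct.map (Ad g) (Ad g) (coproduct N (incl N A))
    simp [-UniversalEnvelopingAlgebra.ι_apply, coproduct_incl, Ad_incl]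
  have h2 : ∀ z : U N ⊗[ℂ] U N, slice φ (Algebra.TensorProduct.map (Ad g) (Ad g) z)
      = Ad g (slice φ z) := by
    intro z
    induction z with
    | zero => simp
    | tmul x y => simp [hφ]
    | add x y hx hy => simp only [map_add, hx, hy]
  rw [convOp_apply, convOp_apply, ← h2]
  exact congrArg _ (DFunLike.congr_fun h1 x)

/-- Convolution by a tracial functional commutes with the inner derivations by elements of `gl_N`,
and therefore preserves the centre. -/
theorem convOp_mem_center {φ : U N →ₗ[ℂ] ℂ} (hφ : ∀ x y, φ (x * y) = φ (y * x)) {x : U N}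
    (hx : x ∈ Subalgebra.center ℂ (U N)) : convOp φ x ∈ Subalgebra.center ℂ (U N) := by
  rw [Subalgebra.mem_center_iff] at hx ⊢
  have h1 : ∀ (a : U N) (z : U N ⊗[ℂ] U N), slice φ ((a ⊗ₜ[ℂ] 1) * z) = a * slice φ z := by
    intro a z
    induction z with
    | zero => simp
    | tmul x y => simp
    | add x y hx hy => simp only [map_add, mul_add, hx, hy]
  have h2 : ∀ (a : U N) (z : U N ⊗[ℂ] U N), slice φ (z * (a ⊗ₜ[ℂ] 1)) = slice φ z * a := by
    intro a z
    induction z with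
    | zero => simp
    | tmul x y => simp
    | add x y hx hy => simp only [map_add, add_mul, hx, hy]
  have h3 : ∀ (a : U N) (z : U N ⊗[ℂ] U N),
      slice φ (z * (1 ⊗ₜ[ℂ] a)) = slice φ ((1 ⊗ₜ[ℂ] a) * z) := by
    intro a z
    induction z with
    | zero => simp
    | tmul x y => simp [hφ a y]
    | add x y hx hy => simp only [map_add, add_mul, mul_add, hx, hy]
  intro y
  induction y using U_induction with
  | halg c => exact Algebra.commutes c _
  | hincl A =>
    have h4 := congrArg (fun y => slice φ (coproduct N y)) (hx (incl N A))
    simp only [map_mul, coproduct_incl, add_mul, mul_add, map_add, h1, h2, h3] at h4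
    -- The terms `φ(a · y)` and `φ(y · a)` of the second leg agree and cancel.
    exact add_right_cancel h4
  | hadd y z hy hz => rw [add_mul, mul_add, hy, hz]
  | hmul y z hy hz => rw [mul_assoc, hz, ← mul_assoc, hy, mul_assoc]

/-! ### Complete positivity -/

theorem star_mul_tensor (z w : U N ⊗[ℂ] U N) : star (z * w) = star w * star z := by
  induction z with
  | zero => simp
  | tmul x y =>
    induction w with
    | zero => simp
    | tmul x' y' => simp
    | add w w' hw hw' => simp only [mul_add, star_add, add_mul, hw, hw']
  | add z z' hz hz' => simp only [mul_add, star_add, add_mul, hz, hz']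

theorem coproduct_star (x : U N) : coproduct N (star x) = star (coproduct N x) := by
  induction x using U_induction with
  | halg c =>
    rw [star_algebraMap, AlgHom.commutes, AlgHom.commutes, Algebra.algebraMap_eq_smul_one,
      Algebra.algebraMap_eq_smul_one, star_smul, Algebra.TensorProduct.one_def,
      TensorProduct.star_tmul, star_one]
  | hincl A =>
    rw [star_incl, coproduct_incl, coproduct_incl, star_add, TensorProduct.star_tmul,
      TensorProduct.star_tmul, star_one, star_incl]
  | hadd x y hx hy => rw [star_add, map_add, map_add, star_add, hx, hy]
  | hmul x y hx hy => rw [star_mul, map_mul, map_mul, star_mul_tensor, hx, hy]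

/-- Finitely many tensors can be written with the same right factors. -/
theorem exists_common_right_factors {β : Type} [Fintype β] (z : β → U N ⊗[ℂ] U N) :
    ∃ (α : Type) (_ : Fintype α) (x : β → α → U N) (y : α → U N),
      ∀ b, z b = ∑ a, x b a ⊗ₜ[ℂ] y a := by
  classical
  choose S hS using fun b => TensorProduct.exists_finset (z b)
  refine ⟨Σ b, S b, inferInstance, fun b a => if a.1 = b then a.2.1.1 else 0,
    fun a => a.2.1.2, fun b => ?_⟩
  rw [Fintype.sum_sigma, Finset.sum_eq_single b]
  · rw [hS, ← Finset.sum_coe_sort]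
    simp
  · intro b' _ hb'
    simp [hb']
  · simp

open scoped ComplexOrder in
/-- Convolution by a state is completely positive: the Gram matrix of the right tensor factors is
of the form `Lᴴ L`, and `L` mixes the left factors into the required square roots. -/
theorem isCompletelyPositive_convOp {φ : U N →ₗ[ℂ] ℂ} (hφ : IsState φ) :
    IsCompletelyPositive (convOp φ) := by
  classical
  intro n B
  obtain ⟨α, _, x, y, hxy⟩ := exists_common_right_factors
    fun b : Fin n × Fin n => coproduct N (B b.1 b.2)
  obtain ⟨L, hL⟩ : ∃ L : Matrix α α ℂ, (Matrix.of fun a b => φ (star (y a) * y b)) = star L * L := by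
    open scoped MatrixOrder Matrix.Norms.L2Operator in
    exact CStarAlgebra.nonneg_iff_eq_star_mul_self.1 (hφ.gram_posSemidef y).nonneg
  have hL' : ∀ a b, φ (star (y a) * y b) = ∑ c, star (L c a) * L c b := fun a b => by
    have := congrFun (congrFun hL a) b
    simpa [Matrix.mul_apply] using this
  have key : (star B * B).map (convOp φ) = ∑ c : α,
      star (Matrix.of fun k j => ∑ a, L c a • x (k, j) a : Matrix (Fin n) (Fin n) (U N)) *
        (Matrix.of fun k j => ∑ a, L c a • x (k, j) a) := by
    ext i j
    rw [Matrix.map_apply, Matrix.mul_apply, map_sum, Matrix.sum_apply]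
    simp only [Matrix.mul_apply]
    rw [Finset.sum_comm]
    refine Finset.sum_congr rfl fun k _ => ?_
    simp only [Matrix.star_apply, Matrix.of_apply]
    rw [convOp_apply, map_mul, coproduct_star, hxy (k, i), hxy (k, j)]
    simp only [star_sum, TensorProduct.star_tmul, Finset.sum_mul_sum, map_sum,
      Algebra.TensorProduct.tmul_mul_tmul, slice_tmul, hL', star_smul, smul_mul_smul_comm,
      Finset.sum_smul]
    symm
    rw [Finset.sum_comm]
    refine Finset.sum_congr rfl fun a _ => ?_
    rw [Finset.sum_comm]
  rw [key]
  exact sum_mem fun c _ => AddSubmonoid.subset_closure ⟨_, rfl⟩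

end

section

open Matrix
open scoped Kronecker

variable {N : ℕ}

/-! ### Traces on tensor powers and the convolution semigroup -/

namespace URep

variable {ι κ : Type} [Fintype ι] [DecidableEq ι] [Fintype κ] [DecidableEq κ]

/-- The trace of a representation, as a functional on the enveloping algebra. -/
def tr (V : URep N ι) : U N →ₗ[ℂ] ℂ := Matrix.traceLinearMap ι ℂ ℂ ∘ₗ V.act.toLinearMap

theorem tr_apply (V : URep N ι) (x : U N) : V.tr x = Matrix.trace (V.act x) := rfl

theorem tr_mul_comm (V : URep N ι) (x y : U N) : V.tr (x * y) = V.tr (y * x) := by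
  rw [tr_apply, tr_apply, map_mul, map_mul, Matrix.trace_mul_comm]

theorem tr_reindex (e : κ ≃ ι) (V : URep N ι) : (V.reindex e).tr = V.tr := by
  ext1 x
  have h : (V.reindex e).act x = (permMatrix e)ᴴ * V.act x * permMatrix e := by
    have h1 : permMatrix e * (V.reindex e).act x = V.act x * permMatrix e :=
      mul_act _ _ (mul_drho _ _ fun g =>
        (V.rho_mul_restrict _ (permMatrix_conjTranspose_mul e) (V.permMatrix_comm e) g).symm) x
    rw [Matrix.mul_assoc, ← h1, ← Matrix.mul_assoc, permMatrix_conjTranspose_mul, Matrix.one_mul]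
  rw [tr_apply, h, Matrix.trace_mul_comm, ← Matrix.mul_assoc, permMatrix_mul_conjTranspose,
    Matrix.one_mul, tr_apply]

/-- Traces are multiplicative for tensor products: `tr_{V ⊗ W} = (tr_V ⊗ tr_W) ∘ Δ`. -/
theorem tr_tensor (V : URep N ι) (W : URep N κ) : (V.tensor W).tr = V.tr ∘ₗ convOp W.tr := by
  let Φ : U N ⊗[ℂ] U N →ₐ[ℂ] Matrix (ι × κ) (ι × κ) ℂ :=
    Algebra.TensorProduct.lift ((kronLeft ι κ).toAlgHom.comp V.act)
      ((kronRight ι κ).toAlgHom.comp W.act) fun x y => commute_kronLeft_kronRight _ _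
  have hΦ : ∀ x y, Φ (x ⊗ₜ[ℂ] y) = kronLeft ι κ (V.act x) * kronRight ι κ (W.act y) :=
    fun x y => Algebra.TensorProduct.lift_tmul _ _ _ x y
  have h1 : (V.tensor W).act = Φ.comp (coproduct N) := by
    apply UniversalEnvelopingAlgebra.hom_ext
    ext1 A
    change (V.tensor W).act (incl N A) = Φ (coproduct N (incl N A))
    rw [act_incl, coproduct_incl, map_add, hΦ, hΦ, map_one, map_one, map_one,
      map_one, mul_one, one_mul, act_incl, act_incl]
    rfl
  have h2 : ∀ z, Matrix.trace (Φ z) = V.tr (slice W.tr z) := by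
    intro z
    induction z with
    | zero => simp
    | tmul x y =>
      rw [hΦ, slice_tmul, map_smul, smul_eq_mul, mul_comm, kronLeft_mul_kronRight,
        Matrix.trace_kronecker]
      rfl
    | add x y hx hy => simp only [map_add, Matrix.trace_add, hx, hy]
  ext1 x
  rw [tr_apply, h1]
  exact h2 _

variable (N) in
theorem tr_tensorPow_zero : (tensorPow N 0).tr = (counit N).toLinearMap := by
  have h : (tensorPow N 0).act = (Algebra.ofId ℂ _).comp (counit N) := by
    apply UniversalEnvelopingAlgebra.hom_ext
    ext1 A
    change (tensorPow N 0).act (incl N A) = Algebra.ofId ℂ _ (counit N (incl N A))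
    rw [act_incl, counit_incl, map_zero]
    rfl
  ext1 x
  rw [tr_apply, h]
  change Matrix.trace (algebraMap ℂ (Matrix (Fin 0 → Fin N) (Fin 0 → Fin N) ℂ) (counit N x)) = _
  rw [Algebra.algebraMap_eq_smul_one, Matrix.trace_smul]
  simp

theorem tr_tensorPow_succ (k : ℕ) :
    (tensorPow N (k + 1)).tr = (std N).tr ∘ₗ convOp (tensorPow N k).tr := by
  rw [tensorPow, tr_reindex, tr_tensor]

theorem tr_tensorPow_add (k m : ℕ) :
    (tensorPow N (k + m)).tr = (tensorPow N k).tr ∘ₗ convOp (tensorPow N m).tr := by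
  induction k with
  | zero => rw [zero_add, tr_tensorPow_zero, counit_convOp]
  | succ k ih =>
    rw [add_right_comm, tr_tensorPow_succ, ih,
      tr_tensorPow_succ, LinearMap.comp_assoc, convOp_comp]

end URep

theorem hasSum_bracket_tr (t : ℝ) (ht : 0 ≤ t) (x : U N) :
    HasSum (fun k => (weight N t k : ℂ) * (URep.tensorPow N k).tr x) (bracket t x) :=
  hasSum_bracket t ht x

/-- The weights form a convolution semigroup (of Poisson type). -/
theorem sum_weight_mul_weight (r s : ℝ) (n : ℕ) :
    ∑ p ∈ Finset.HasAntidiagonal.antidiagonal n, weight N r p.1 * weight N s p.2 = weight N (r + s) n := by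
  have h1 : (r + s) ^ n / n.factorial
      = ∑ p ∈ Finset.HasAntidiagonal.antidiagonal n, r ^ p.1 / p.1.factorial * (s ^ p.2 / p.2.factorial) := by
    rw [(Commute.all r s).add_pow', Finset.sum_div]
    refine Finset.sum_congr rfl fun p hp => ?_
    have hn : p.1 + p.2 = n := Finset.HasAntidiagonal.mem_antidiagonal.1 hp
    have h2 : ((n.choose p.1 : ℝ)) * p.1.factorial * p.2.factorial = n.factorial := by
      rw [← hn, Nat.choose_symm_add]
      exact_mod_cast Nat.add_choose_mul_factorial_mul_factorial p.1 p.2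
    have h3 : (p.1.factorial : ℝ) ≠ 0 := by positivity
    have h4 : (p.2.factorial : ℝ) ≠ 0 := by positivity
    have h5 : (n.factorial : ℝ) ≠ 0 := by positivity
    rw [nsmul_eq_mul]
    field_simp
    rw [← h2]
    ring
  unfold weight
  rw [h1, Finset.mul_sum]
  refine Finset.sum_congr rfl fun p _ => ?_
  rw [show -((r + s) * (N : ℝ)) = -(r * N) + -(s * N) by ring, Real.exp_add]
  ring

/-- The functionals `⟨·⟩_t` form a convolution semigroup. -/
theorem bracket_convOp (r s : ℝ) (hr : 0 ≤ r) (hs : 0 ≤ s) :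
    bracket (N := N) r ∘ₗ convOp (bracket s) = bracket (r + s) := by
  -- The Cauchy product of the two series, for every tensor in place of `Δ X`.
  have key : ∀ z : U N ⊗[ℂ] U N,
      HasSum (fun n => ∑ p ∈ Finset.HasAntidiagonal.antidiagonal n, ((weight N r p.1 * weight N s p.2 : ℝ) : ℂ) *
        (URep.tensorPow N p.1).tr (slice (URep.tensorPow N p.2).tr z))
        (bracket r (slice (bracket s) z)) := by
    intro z
    induction z with
    | zero => simp
    | tmul x y =>
      have hx := hasSum_bracket_tr r hr x
      have hy := hasSum_bracket_tr s hs y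
      have h1 := (summable_norm_sum_mul_antidiagonal_of_summable_norm hx.summable.norm
        hy.summable.norm).of_norm.hasSum
      rw [← tsum_mul_tsum_eq_tsum_sum_antidiagonal_of_summable_norm hx.summable.norm
        hy.summable.norm, hx.tsum_eq, hy.tsum_eq] at h1
      rw [slice_tmul, map_smul, smul_eq_mul, mul_comm]
      refine h1.congr_fun fun n => Finset.sum_congr rfl fun p _ => ?_
      rw [slice_tmul, map_smul, smul_eq_mul]
      push_cast
      ring
    | add x y hx hy =>
      rw [map_add, map_add]
      refine (hx.add hy).congr_fun fun n => ?_
      rw [← Finset.sum_add_distrib]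
      exact Finset.sum_congr rfl fun p _ => by rw [map_add, map_add, mul_add]
  ext1 x
  refine (key (coproduct N x)).unique ?_
  refine (hasSum_bracket_tr (r + s) (add_nonneg hr hs) x).congr_fun fun n => ?_
  rw [← sum_weight_mul_weight, Complex.ofReal_sum, Finset.sum_mul]
  refine Finset.sum_congr rfl fun p hp => ?_
  rw [← Finset.HasAntidiagonal.mem_antidiagonal.1 hp, URep.tr_tensorPow_add]
  rfl

theorem bracket_mul_comm (t : ℝ) (ht : 0 ≤ t) (x y : U N) :
    bracket t (x * y) = bracket t (y * x) :=
  (hasSum_bracket_tr t ht (x * y)).unique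
    ((hasSum_bracket_tr t ht (y * x)).congr_fun fun k => by rw [URep.tr_mul_comm])

theorem bracket_Ad (t : ℝ) (ht : 0 ≤ t) (g : G N) (x : U N) :
    bracket t (Ad g x) = bracket t x :=
  (hasSum_bracket_tr t ht (Ad g x)).unique
    ((hasSum_bracket_tr t ht x).congr_fun fun k => by
      rw [URep.tr_apply, URep.trace_act_Ad, URep.tr_apply])

theorem bracket_zero : bracket (N := N) 0 = (counit N).toLinearMap := by
  ext1 x
  refine (hasSum_bracket_tr 0 le_rfl x).unique ?_
  convert hasSum_single 0 fun k hk => ?_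
  · simp [weight, URep.tr_tensorPow_zero]
  · simp [weight, hk]

theorem P_zero : P (N := N) 0 = LinearMap.id := by
  rw [P_eq_convOp, bracket_zero, convOp_counit]

theorem P_add (r s : ℝ) (hr : 0 ≤ r) (hs : 0 ≤ s) : P (N := N) (r + s) = P r ∘ₗ P s := by
  rw [P_eq_convOp, P_eq_convOp, P_eq_convOp, convOp_comp, bracket_convOp r s hr hs]

theorem P_one (t : ℝ) (ht : 0 ≤ t) : P (N := N) t 1 = 1 := by
  rw [P_eq_convOp, convOp_apply, map_one, Algebra.TensorProduct.one_def, slice_tmul,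
    (isState_bracket t ht).map_one, one_smul]

theorem isMarkov_P : IsMarkov (P (N := N)) where
  unital := P_one
  completelyPositive t ht := isCompletelyPositive_convOp (isState_bracket t ht)
  semigroup := P_add

end

section

open Matrix

/-! ### Product functionals on infinite tensor products -/

section Product

variable {A : Type} [Ring A] [Algebra ℂ A]

variable (A) in
/-- The span of the tensors `⊗ a_k` with `a_k = 1` for `k ≥ n`. -/
def initial (n : ℕ) : Submodule ℂ (FullTensor A) :=
  Submodule.span ℂ {w | ∃ a : ℕ → A, (∀ k, n ≤ k → a k = 1) ∧ w = PiTensorProduct.tprod ℂ a}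

theorem tprod_mem_initial {n : ℕ} {a : ℕ → A} (ha : ∀ k, n ≤ k → a k = 1) :
    PiTensorProduct.tprod ℂ a ∈ initial A n :=
  Submodule.subset_span ⟨a, ha, rfl⟩

theorem initial_mono {m n : ℕ} (h : m ≤ n) : initial A m ≤ initial A n :=
  Submodule.span_mono fun _ ⟨a, ha, hw⟩ => ⟨a, fun k hk => ha k (h.trans hk), hw⟩

theorem one_mem_initial (n : ℕ) : (1 : FullTensor A) ∈ initial A n :=
  tprod_mem_initial (a := 1) fun _ _ => rfl

theorem mul_mem_initial {n : ℕ} {x y : FullTensor A} (hx : x ∈ initial A n)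
    (hy : y ∈ initial A n) : x * y ∈ initial A n := by
  induction hx using Submodule.span_induction with
  | zero => rw [zero_mul]; exact zero_mem _
  | add x x' _ _ h h' => rw [add_mul]; exact add_mem h h'
  | smul c x _ h => rw [smul_mul_assoc]; exact Submodule.smul_mem _ c h
  | mem x hx =>
    obtain ⟨a, ha, rfl⟩ := hx
    induction hy using Submodule.span_induction with
    | zero => rw [mul_zero]; exact zero_mem _
    | add y y' _ _ h h' => rw [mul_add]; exact add_mem h h'
    | smul c y _ h => rw [mul_smul_comm]; exact Submodule.smul_mem _ c h
    | mem y hy =>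
      obtain ⟨b, hb, rfl⟩ := hy
      rw [PiTensorProduct.tprod_mul_tprod]
      exact tprod_mem_initial fun k hk => by rw [Pi.mul_apply, ha k hk, hb k hk, mul_one]

variable {φ : ℕ → A →ₗ[ℂ] ℂ}

/-- The product functional on an elementary tensor is a finite product (and not the junk value of
`prodMultilinear`), since all but finitely many factors are `1`. -/
theorem lift_prodMultilinear_tprod (hφ : ∀ k, φ k 1 = 1) {n : ℕ} {a : ℕ → A}
    (ha : ∀ k, n ≤ k → a k = 1) :
    PiTensorProduct.lift (prodMultilinear φ) (PiTensorProduct.tprod ℂ a)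
      = ∏ k ∈ Finset.range n, φ k (a k) := by
  rw [PiTensorProduct.lift.tprod]
  have hsub : {k | φ k (a k) ≠ 1} ⊆ Finset.range n := fun k hk => by
    by_contra h
    exact hk (by rw [ha k (by simpa using h), hφ])
  classical
  change (if {k | φ k (a k) ≠ 1}.Finite then ∏ᶠ k, φ k (a k) else 0) = _
  rw [if_pos ((Finset.finite_toSet _).subset hsub)]
  exact finprod_eq_prod_of_mulSupport_subset _ hsub

variable [StarRing A] [StarModule ℂ A]

theorem star_tprod (a : ℕ → A) :
    star (PiTensorProduct.tprod ℂ a : FullTensor A) = PiTensorProduct.tprod ℂ fun k => star (a k) := by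
  have := tensorStar_smul_tprod A 1 a
  rwa [one_smul, star_one, one_smul] at this

theorem star_mem_initial {n : ℕ} {x : FullTensor A} (hx : x ∈ initial A n) :
    star x ∈ initial A n := by
  induction hx using Submodule.span_induction with
  | zero => rw [star_zero]; exact zero_mem _
  | add x x' _ _ h h' => rw [star_add]; exact add_mem h h'
  | smul c x _ h => rw [star_smul]; exact Submodule.smul_mem _ _ h
  | mem x hx =>
    obtain ⟨a, ha, rfl⟩ := hx
    rw [star_tprod]
    exact tprod_mem_initial fun k hk => by rw [ha k hk, star_one]

theorem coe_slot (k : ℕ) (a : A) :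
    (slot A k a : FullTensor A) = PiTensorProduct.tprod ℂ (Pi.mulSingle k a) := rfl

theorem slot_mem_initial {k n : ℕ} (h : k < n) (a : A) :
    (slot A k a : FullTensor A) ∈ initial A n :=
  tprod_mem_initial (a := Pi.mulSingle k a)
    fun _ hl => by simp [(h.trans_le hl).ne']

theorem exists_mem_initial (w : TensorPower A) : ∃ n, (w : FullTensor A) ∈ initial A n := by
  obtain ⟨w, hw⟩ := w
  change ∃ n, w ∈ initial A n
  induction hw using StarAlgebra.adjoin_induction with
  | mem x hx =>
    obtain ⟨k, a, rfl⟩ := Set.mem_iUnion.1 hx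
    exact ⟨k + 1, slot_mem_initial (Nat.lt_succ_self k) a⟩
  | algebraMap r =>
    rw [Algebra.algebraMap_eq_smul_one]
    exact ⟨0, Submodule.smul_mem _ r (one_mem_initial 0)⟩
  | add x y _ _ hx hy =>
    obtain ⟨n, hn⟩ := hx
    obtain ⟨m, hm⟩ := hy
    exact ⟨max n m, add_mem (initial_mono (le_max_left _ _) hn) (initial_mono (le_max_right _ _) hm)⟩
  | mul x y _ _ hx hy =>
    obtain ⟨n, hn⟩ := hx
    obtain ⟨m, hm⟩ := hy
    exact ⟨max n m,
      mul_mem_initial (initial_mono (le_max_left _ _) hn) (initial_mono (le_max_right _ _) hm)⟩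
  | star x _ hx =>
    obtain ⟨n, hn⟩ := hx
    exact ⟨n, star_mem_initial hn⟩

/-- Elements of the first `n` slots commute with the slot `n`. -/
theorem commute_slot {n : ℕ} {w : TensorPower A} (hw : (w : FullTensor A) ∈ initial A n) (b : A) :
    Commute (slot A n b) w := by
  refine Subtype.ext ?_
  change (slot A n b : FullTensor A) * (w : FullTensor A) = w * slot A n b
  rw [coe_slot]
  generalize (w : FullTensor A) = w at hw ⊢
  induction hw using Submodule.span_induction with
  | zero => rw [zero_mul, mul_zero]
  | add x x' _ _ h h' => rw [add_mul, mul_add, h, h']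
  | smul c x _ h => rw [smul_mul_assoc, mul_smul_comm, h]
  | mem x hx =>
    obtain ⟨a, ha, rfl⟩ := hx
    rw [PiTensorProduct.tprod_mul_tprod, PiTensorProduct.tprod_mul_tprod]
    congr 1
    ext k
    by_cases hk : k = n
    · subst hk; simp [ha k le_rfl]
    · simp [Pi.mulSingle_eq_of_ne hk]

theorem prodFunctional_apply (w : TensorPower A) :
    prodFunctional φ w = PiTensorProduct.lift (prodMultilinear φ) (w : FullTensor A) := rfl

/-- The product functional is multiplicative with respect to a new slot. -/
theorem prodFunctional_mul_slot (hφ : ∀ k, φ k 1 = 1) {n : ℕ} {w : TensorPower A}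
    (hw : (w : FullTensor A) ∈ initial A n) (b : A) :
    prodFunctional φ (w * slot A n b) = φ n b * prodFunctional φ w := by
  rw [prodFunctional_apply, prodFunctional_apply]
  change PiTensorProduct.lift (prodMultilinear φ) ((w : FullTensor A) * slot A n b) = _
  rw [coe_slot]
  generalize (w : FullTensor A) = w at hw ⊢
  induction hw using Submodule.span_induction with
  | zero => simp
  | add x x' _ _ h h' => rw [add_mul, map_add, map_add, h, h', mul_add]
  | smul c x _ h => rw [smul_mul_assoc, map_smul, map_smul, h, smul_eq_mul, smul_eq_mul]; ring
  | mem x hx =>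
    obtain ⟨a, ha, rfl⟩ := hx
    rw [PiTensorProduct.tprod_mul_tprod, lift_prodMultilinear_tprod hφ ha,
      lift_prodMultilinear_tprod hφ (n := n + 1), Finset.prod_range_succ, mul_comm]
    · congr 1
      · simp [ha n le_rfl]
      · refine Finset.prod_congr rfl fun k hk => ?_
        rw [Pi.mul_apply, Pi.mulSingle_eq_of_ne (Finset.mem_range.1 hk).ne, mul_one]
    · intro k hk
      rw [Pi.mul_apply, Pi.mulSingle_eq_of_ne (by omega), ha k (by omega), mul_one]

open scoped ComplexOrder in
/-- Products of states are positive, by the Schur product theorem for Gram matrices. -/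
theorem prodFunctional_nonneg (hφ : ∀ k, IsState (φ k)) (w : TensorPower A) :
    0 ≤ prodFunctional φ (star w * w) := by
  obtain ⟨n, hn⟩ := exists_mem_initial w
  rw [prodFunctional_apply]
  change 0 ≤ PiTensorProduct.lift (prodMultilinear φ) (star (w : FullTensor A) * w)
  obtain ⟨r, c, g, hg⟩ := (Submodule.mem_span_set').1 hn
  choose a ha hga using fun i => (g i).2
  simp only [hga] at hg
  have hpsd : ∀ m : ℕ, (Matrix.of fun i j : Fin r =>
      ∏ k ∈ Finset.range m, φ k (star (a i k) * a j k)).PosSemidef := by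
    intro m
    induction m with
    | zero =>
      convert (hφ 0).gram_posSemidef fun _ : Fin r => (1 : A) using 2
      simp [(hφ 0).map_one]
    | succ m ih =>
      have h := ih.hadamard ((hφ m).gram_posSemidef fun i => a i m)
      have h1 : (Matrix.of fun i j : Fin r =>
          ∏ k ∈ Finset.range (m + 1), φ k (star (a i k) * a j k))
          = (Matrix.of fun i j : Fin r => ∏ k ∈ Finset.range m, φ k (star (a i k) * a j k))
            ⊙ Matrix.of fun i j => φ m (star (a i m) * a j m) := by
        ext i j
        simp [Finset.prod_range_succ, Matrix.hadamard_apply]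
      rw [h1]
      exact h
  have h1 : PiTensorProduct.lift (prodMultilinear φ) (star (w : FullTensor A) * w)
      = star c ⬝ᵥ ((Matrix.of fun i j : Fin r =>
          ∏ k ∈ Finset.range n, φ k (star (a i k) * a j k)) *ᵥ c) := by
    rw [← hg, star_sum, Finset.sum_mul_sum, map_sum]
    simp only [dotProduct, Matrix.mulVec, Finset.mul_sum, map_sum]
    refine Finset.sum_congr rfl fun i _ => Finset.sum_congr rfl fun j _ => ?_
    rw [star_smul, smul_mul_smul_comm, map_smul, star_tprod, PiTensorProduct.tprod_mul_tprod,
      lift_prodMultilinear_tprod (fun k => (hφ k).map_one) (n := n)]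
    · simp only [Matrix.of_apply, Pi.mul_apply, Pi.star_apply, smul_eq_mul]; ring
    · intro k hk
      rw [Pi.mul_apply, ha i k hk, ha j k hk, star_one, mul_one]
  rw [h1]
  exact (hpsd n).dotProduct_mulVec_nonneg c

theorem isState_prodFunctional (hφ : ∀ k, IsState (φ k)) : IsState (prodFunctional φ) where
  map_one := by
    rw [prodFunctional_apply]
    have := lift_prodMultilinear_tprod (fun k => (hφ k).map_one) (n := 0) (a := (1 : ℕ → A))
      fun _ _ => rfl
    rwa [Finset.prod_range_zero] at this
  im_eq_zero w := (Complex.nonneg_iff.1 (prodFunctional_nonneg hφ w)).2.symm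
  re_nonneg w := (Complex.nonneg_iff.1 (prodFunctional_nonneg hφ w)).1

end Product

/-! ### The dilation -/

variable {N : ℕ}

theorem j_incl (n : ℕ) (A : gl N) :
    j N n (incl N A) = ∑ k ∈ Finset.range (n + 1), slot (M N) k (piM N (incl N A)) :=
  UniversalEnvelopingAlgebra.lift_ι_apply ℂ _ A

theorem j_mem_initial (n : ℕ) (x : U N) : (j N n x : FullTensor (M N)) ∈ initial (M N) (n + 1) := by
  induction x using U_induction with
  | halg c =>
    rw [AlgHom.commutes, Algebra.algebraMap_eq_smul_one]
    exact Submodule.smul_mem _ c (one_mem_initial _)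
  | hincl A =>
    rw [j_incl, AddSubmonoidClass.coe_finsetSum]
    exact sum_mem fun k hk => slot_mem_initial (Finset.mem_range.1 hk) _
  | hadd x y hx hy => rw [map_add]; exact add_mem hx hy
  | hmul x y hx hy => rw [map_mul]; exact mul_mem_initial hx hy

theorem past_subset_initial {n : ℕ} {w : W N} (hw : w ∈ past (j N) n) :
    (w : FullTensor (M N)) ∈ initial (M N) (n + 1) := by
  induction hw using Algebra.adjoin_induction with
  | mem x hx =>
    simp only [Set.mem_iUnion, Finset.mem_range] at hx
    obtain ⟨m, hm, y, rfl⟩ := hx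
    exact initial_mono (by omega) (j_mem_initial m y)
  | algebraMap r =>
    rw [Algebra.algebraMap_eq_smul_one]
    exact Submodule.smul_mem _ r (one_mem_initial _)
  | add x y _ _ hx hy => exact add_mem hx hy
  | mul x y _ _ hx hy => exact mul_mem_initial hx hy

variable (N) in
/-- The morphism `x ⊗ y ↦ j_n(x) π(y)`, with `π(y)` in the slot `n + 1`. -/
def jStep (n : ℕ) : U N ⊗[ℂ] U N →ₐ[ℂ] W N :=
  Algebra.TensorProduct.lift (j N n) ((slot (M N) (n + 1)).comp (piM N))
    fun x y => (commute_slot (j_mem_initial n x) (piM N y)).symm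

theorem jStep_tmul (n : ℕ) (x y : U N) :
    jStep N n (x ⊗ₜ[ℂ] y) = j N n x * slot (M N) (n + 1) (piM N y) :=
  Algebra.TensorProduct.lift_tmul _ _ _ x y

/-- `j_{n+1}` is built from `j_n` and the new slot by means of the coproduct. -/
theorem j_succ (n : ℕ) (x : U N) : j N (n + 1) x = jStep N n (coproduct N x) := by
  have h : j N (n + 1) = (jStep N n).comp (coproduct N) := by
    apply UniversalEnvelopingAlgebra.hom_ext
    ext1 A
    change j N (n + 1) (incl N A) = jStep N n (coproduct N (incl N A))
    rw [coproduct_incl, map_add, jStep_tmul, jStep_tmul, map_one, map_one, map_one, mul_one,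
      one_mul, j_incl, j_incl, Finset.sum_range_succ _ (n + 1)]
  exact DFunLike.congr_fun h x

theorem increment_nonneg {t : ℕ → ℝ} (ht0 : 0 ≤ t 0) (ht : StrictMono t) (k : ℕ) :
    0 ≤ increment t k := by
  cases k with
  | zero => exact ht0
  | succ k => exact sub_nonneg.2 (ht (Nat.lt_succ_self k)).le

/-- Integrating out the last increment replaces `j_{n+1}(X)` by `j_n(P X)`. -/
theorem omega_mul_j_succ_mul {t : ℕ → ℝ} (ht0 : 0 ≤ t 0) (ht : StrictMono t) {n : ℕ} {u w : W N}
    (hu : (u : FullTensor (M N)) ∈ initial (M N) (n + 1))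
    (hw : (w : FullTensor (M N)) ∈ initial (M N) (n + 1)) (x : U N) :
    omega t (u * j N (n + 1) x * w) = omega t (u * j N n (P (t (n + 1) - t n) x) * w) := by
  have key : ∀ z : U N ⊗[ℂ] U N, omega t (u * jStep N n z * w)
      = omega t (u * j N n (slice (bracket (t (n + 1) - t n)) z) * w) := by
    intro z
    induction z with
    | zero => simp
    | tmul x y =>
      rw [jStep_tmul, slice_tmul, map_smul, mul_smul_comm, smul_mul_assoc, map_smul, smul_eq_mul,
        mul_assoc, mul_assoc, (commute_slot hw _).eq, ← mul_assoc, ← mul_assoc]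
      exact prodFunctional_mul_slot
        (fun k => (isState_kappa _ (increment_nonneg ht0 ht k)).map_one)
        (mul_mem_initial (mul_mem_initial hu (j_mem_initial n x)) hw) _
    | add x y hx hy => simp only [map_add, mul_add, add_mul, hx, hy]
  rw [j_succ, key]
  rfl

theorem omega_j {t : ℕ → ℝ} (ht0 : 0 ≤ t 0) (ht : StrictMono t) (n : ℕ) (x : U N) :
    omega t (j N n x) = bracket (t n) x := by
  induction n generalizing x with
  | zero =>
    have h1 : j N 0 = (slot (M N) 0).comp (piM N) := by
      apply UniversalEnvelopingAlgebra.hom_ext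
      ext1 A
      change j N 0 (incl N A) = slot (M N) 0 (piM N (incl N A))
      rw [j_incl]; simp
    have hφ : ∀ k, kappa (N := N) (increment t k) 1 = 1 :=
      fun k => (isState_kappa _ (increment_nonneg ht0 ht k)).map_one
    have h2 := prodFunctional_mul_slot (φ := fun k => kappa (N := N) (increment t k)) hφ
      (n := 0) (w := 1) (one_mem_initial 0) (piM N x)
    have h3 : prodFunctional (fun k => kappa (N := N) (increment t k)) 1 = 1 :=
      (isState_prodFunctional fun k => isState_kappa _ (increment_nonneg ht0 ht k)).map_one
    rw [one_mul, h3, mul_one] at h2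
    rw [h1]
    exact h2
  | succ n ih =>
    have h := omega_mul_j_succ_mul ht0 ht (n := n) (u := 1) (w := 1) (one_mem_initial _)
      (one_mem_initial _) x
    have h0 : 0 ≤ t n := ht0.trans (ht.monotone (Nat.zero_le n))
    have h1 : 0 ≤ t (n + 1) - t n := sub_nonneg.2 (ht (Nat.lt_succ_self n)).le
    have h2 := bracket_convOp (N := N) (t n) (t (n + 1) - t n) h0 h1
    rw [add_sub_cancel] at h2
    rw [one_mul, mul_one, one_mul, mul_one, ih] at h
    rw [h, ← h2]
    rfl

/-- Iteration of `omega_mul_j_succ_mul` by the semigroup law. -/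
theorem omega_mul_j {t : ℕ → ℝ} (ht0 : 0 ≤ t 0) (ht : StrictMono t) {n : ℕ} {u : W N}
    (hu : (u : FullTensor (M N)) ∈ initial (M N) (n + 1)) {m : ℕ} (hnm : n ≤ m) (y : U N) :
    omega t (u * j N m y) = omega t (u * j N n (P (t m - t n) y)) := by
  induction m, hnm using Nat.le_induction generalizing y with
  | base => rw [sub_self, P_zero, LinearMap.id_apply]
  | succ m hnm ih =>
    have h := omega_mul_j_succ_mul ht0 ht (n := m) (w := 1)
      (initial_mono (by omega) hu) (one_mem_initial _) y
    rw [mul_one, mul_one] at h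
    have h1 := P_add (N := N) (t m - t n) (t (m + 1) - t m) (sub_nonneg.2 (ht.monotone hnm))
      (sub_nonneg.2 (ht (Nat.lt_succ_self m)).le)
    rw [sub_add_sub_cancel'] at h1
    rw [h, ih, h1]
    rfl

end

end NCWalk

end

theorem mainTheorem2 (N : ℕ) (t : ℕ → ℝ) (ht0 : 0 ≤ t 0) (ht : StrictMono t) :
    -- the series defining the states on `M` converge, and they define states
    (∀ s : ℝ, 0 ≤ s → (∀ T : NCWalk.M N, HasSum (NCWalk.stateTerm s T) (NCWalk.kappa s T)) ∧
      NCWalk.IsState (NCWalk.kappa (N := N) s) ∧ NCWalk.IsState (NCWalk.bracket (N := N) s)) ∧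
    -- (1)
    (NCWalk.IsMarkov (NCWalk.P (N := N)) ∧
      NCWalk.IsDilation (NCWalk.P (N := N)) t (NCWalk.j N) (NCWalk.omega t)) ∧
    -- (2)
    (∀ (n : ℕ) (X : NCWalk.U N), NCWalk.bracket (t n) X = NCWalk.omega t (NCWalk.j N n X)) ∧
    -- (3)
    (∀ (n m : ℕ), n ≤ m → ∀ X Y : NCWalk.U N,
      NCWalk.omega t (NCWalk.j N n X * NCWalk.j N m Y)
        = NCWalk.bracket (t n) (X * NCWalk.P (t m - t n) Y)) ∧
    -- (4)
    (∀ r s : ℝ, 0 ≤ r → 0 ≤ s →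
      NCWalk.P (N := N) (r + s) = NCWalk.P (N := N) r ∘ₗ NCWalk.P (N := N) s) ∧
    -- (5)
    ((∀ (K : Subgroup (NCWalk.G N)) (s : ℝ), 0 ≤ s →
        ∀ X ∈ NCWalk.invariants K, NCWalk.P s X ∈ NCWalk.invariants K) ∧
      ∀ s : ℝ, 0 ≤ s → ∀ X ∈ Subalgebra.center ℂ (NCWalk.U N),
        NCWalk.P s X ∈ Subalgebra.center ℂ (NCWalk.U N)) := by
  refine ⟨fun s hs => ⟨NCWalk.hasSum_kappa s hs, NCWalk.isState_kappa s hs,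
    NCWalk.isState_bracket s hs⟩, ⟨NCWalk.isMarkov_P, ?_, ?_⟩, fun n X => ?_, fun n m hnm X Y => ?_,
    NCWalk.P_add, fun K s hs X hX g hg => ?_, fun s hs X hX => ?_⟩
  · exact NCWalk.isState_prodFunctional
      fun k => NCWalk.isState_kappa _ (NCWalk.increment_nonneg ht0 ht k)
  · intro n x w hw
    have h := NCWalk.omega_mul_j_succ_mul ht0 ht (n := n) (u := 1) (NCWalk.one_mem_initial _)
      (NCWalk.past_subset_initial hw) x
    rwa [one_mul, one_mul] at h
  · rw [NCWalk.omega_j ht0 ht]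
  · rw [NCWalk.omega_mul_j ht0 ht (NCWalk.j_mem_initial n X) hnm, ← map_mul,
      NCWalk.omega_j ht0 ht]
  · rw [NCWalk.P_eq_convOp, ← NCWalk.convOp_Ad (NCWalk.bracket_Ad s hs g), hX g hg]
  · exact NCWalk.convOp_mem_center (NCWalk.bracket_mul_comm s hs) hX
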